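/- Let $X$ be a quasi-compact separated scheme and let $\pi\colon\mathbb A^1_X\to X$ be its affine line, with coordinate function $T\in\Gamma(\mathbb A^1_X,\mathcal O)$. Write $\mathrm{Qcoh}(Y)$ for the category of quasi-coherent $\mathcal O_Y$-modules on a scheme $Y$. Let $\mathcal L$ be the loop category: it has one object $\bullet$, and the endomorphism monoid of $\bullet$ is $(\mathbb N,+)$. For categories $\mathcal C$ and $I$, write $\mathcal C^I$ for the category of functors $I\to\mathcal C$. (1) For every quasi-coherent module $M$ on $\mathbb A^1_X$ the module $\pi_*M$ is quasi-coherent, and the functor $$e\colon \mathrm{Qcoh}(\mathbb A^1_X)\longrightarrow \mathrm{Qcoh}(X)^{\mathcal L},\qquad M\longmapsto\bigl(\bullet\mapsto \pi_*M,\ n\mapsto (T^n\cdot-)\bigr)$$ is an equivalence of categories. (2) For a scheme $Y$ let $\mathbb D_Y$ be the prederivator $\mathbb D_Y(I)=D(\mathrm{Qcoh}(Y)^I)$; it is a strict 2-functor from small categories to categories that reverses the direction of functors and keeps the direction of natural transformations. Here $D(\mathcal A)=\mathrm{Ch}(\mathcal A)[\{\text{quasi-isomorphisms}\}^{-1}]$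 is the (unbounded) derived category of an abelian category $\mathcal A$, and a functor $u\colon I\to J$ acts by restriction along $u$. Let $(\mathbb D_X)^{\mathcal L}$ be the shifted prederivator $I\mapsto \mathbb D_X(\mathcal L\times I)$. Then there is a strong equivalence of derivators $$\mathbb D_{\mathbb A^1_X}\;\simeq\;(\mathbb D_X)^{\mathcal L},$$ that is, there are strict 2-natural transformations in both directions whose two composites are isomorphic to the identities by invertible modifications. It is induced by $e$: for every small category $I$, its component $D(\mathrm{Qcoh}(\mathbb A^1_X)^I)\to D(\mathrm{Qcoh}(X)^{\mathcal L\times I})$, composed with the localization functor from complexes, equals the functor that applies the functor $\mathrm{Qcoh}(\mathbb A^1_X)^I\to \mathrm{Qcoh}(X)^{\mathcal L\times I}$, $F\mapsto\bigl((\bullet,i)\mapsto e(F(i))(\bullet)\bigr)$, degreewise to complexes, followed by localization. -/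

import Mathlib

universe u v w

open CategoryTheory Limits Opposite

/-! ## Quasi-coherent sheaves form an abelian category -/

open AlgebraicGeometry

namespace AlgebraicGeometry.Scheme

open TopologicalSpace
open scoped ZeroObject

/-- The property of being a quasi-coherent `𝒪_X`-module. -/
abbrev isQcoh (X : Scheme.{u}) : ObjectProperty X.Modules :=
  fun M ↦ SheafOfModules.IsQuasicoherent (R := X.ringCatSheaf) M

/-- The category `Qcoh(X)`: the full subcategory of quasi-coherent `𝒪_X`-modules. -/
abbrev Qcoh (X : Scheme.{u}) : Type (u + 1) := X.isQcoh.FullSubcategory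

variable {X : Scheme.{u}}




lemma Modules.isQuasicoherent_of_cover (M : X.Modules)
    (h : ∀ x : X, ∃ U : X.Opens, x ∈ U ∧ Nonempty (M.restrict U.ι).Presentation) :
    M.IsQuasicoherent := by
  choose U hU P using h
  let D : SheafOfModules.QuasicoherentData.{u, u, u, u} M := by
    refine SheafOfModules.QuasicoherentData.mk (R := X.ringCatSheaf) (M := M) X U ?_ fun x ↦ ?_
    · rw [Opens.coversTop_iff]
      exact top_le_iff.mp fun x _ ↦ Opens.mem_iSup.mpr ⟨x, hU x⟩
    · have e := (Modules.overFunctorEquiv (U x)).app M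
      have e1 : (Modules.overEquiv (U x)).functor.obj (SheafOfModules.unit _) ≅ SheafOfModules.unit _ := 
        (Modules.overFunctorEquiv (U x)).app (SheafOfModules.unit _) ≪≫ Modules.restrictUnitIso _
      have e2 := (Modules.overEquiv (U x)).unitIso.app (SheafOfModules.unit _) ≪≫ (Modules.overEquiv (U x)).inverse.mapIso e1
      have e3 := (Modules.overEquiv (U x)).inverse.mapIso e.symm ≪≫ (Modules.overEquiv (U x)).unitIso.symm.app _
      have i1 : PreservesColimitsOfSize.{u, u} (Modules.overEquiv (U x)).inverse := inferInstance
      let F : SheafOfModules.{u} (U x).toScheme.ringCatSheaf ⥤ SheafOfModules.{u} (X.ringCatSheaf.over (U x)) :=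
        (Modules.overEquiv (U x)).inverse
      have i2 : PreservesColimitsOfSize.{u, u} F := i1
      exact SheafOfModules.Presentation.ofIsIso.{u,u,u} e3.hom ((P x).some.map F e2)
  exact D.isQuasicoherent


lemma Modules.kernel_sections {K M N : X.Modules} (i : K ⟶ M) (g : M ⟶ N) (w : i ≫ g = 0)
    (h : IsLimit (KernelFork.ofι i w)) (U : X.Opens) :
    Function.Injective (i.app U) ∧ ∀ x, g.app U x = 0 → ∃ y, i.app U y = x := by
  let S : ShortComplex X.Modules := ⟨i, g, w⟩
  have hS : S.Exact := S.exact_of_f_is_kernel h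
  have : Mono S.f := Fork.IsLimit.mono h
  let F : X.Modules ⥤ Ab.{u} := Modules.toPresheaf X ⋙ (CategoryTheory.evaluation _ _).obj (op U)
  have : PreservesLimits (Modules.toPresheaf X) := inferInstance
  have : PreservesLimits ((CategoryTheory.evaluation (Opens X)ᵒᵖ Ab.{u}).obj (op U)) :=
    ⟨inferInstance⟩
  have : PreservesLimits F := comp_preservesLimits _ _
  have : F.PreservesZeroMorphisms := ⟨fun _ _ ↦ rfl⟩
  have h1 := hS.map_of_mono_of_preservesKernel F inferInstance inferInstance
  rw [ShortComplex.ab_exact_iff] at h1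
  have h2 : Mono (F.map S.f) := inferInstance
  exact ⟨(AddCommGrpCat.mono_iff_injective _).1 h2, h1⟩

lemma Modules.isQuasicoherent_of_sectionwise_kernel {R : CommRingCat.{u}}
    {K M N : (Spec R).Modules} (i : K ⟶ M) (g : M ⟶ N) (w : i ≫ g = 0)
    (h : ∀ U, Function.Injective (i.app U) ∧ ∀ x, g.app U x = 0 → ∃ y, i.app U y = x)
    [hM : M.IsQuasicoherent] [hN : N.IsQuasicoherent] : K.IsQuasicoherent := by
  rw [isQuasicoherent_iff_isIso_fromTildeΓ, isIso_fromTildeΓ_iff_isLocalizing] at hM hN ⊢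
  intro f
  let V : (Spec R).Opens := PrimeSpectrum.basicOpen f
  let r (L : (Spec R).Modules) :
      Γ(L, ⊤) →ₗ[R] Γ(L, V) := ((modulesSpecToSheaf.obj L).obj.map V.leTop.op).hom
  have hrM : IsLocalizedModule.Away f (r M) := hM f
  have hrN : IsLocalizedModule.Away f (r N) := hN f
  let iT : Γ(K, ⊤) →ₗ[R] Γ(M, ⊤) := ((modulesSpecToSheaf.map i).hom.app (op ⊤)).hom
  let iV : Γ(K, V) →ₗ[R] Γ(M, V) := ((modulesSpecToSheaf.map i).hom.app (op V)).hom
  let gT : Γ(M, ⊤) →ₗ[R] Γ(N, ⊤) := ((modulesSpecToSheaf.map g).hom.app (op ⊤)).hom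
  let gV : Γ(M, V) →ₗ[R] Γ(N, V) := ((modulesSpecToSheaf.map g).hom.app (op V)).hom
  have hiT : Function.Injective iT := (h ⊤).1
  have hiV : Function.Injective iV := (h V).1
  have hgT : ∀ x, gT x = 0 → ∃ y, iT y = x := (h ⊤).2
  have hw : ∀ x, gV (iV x) = 0 := fun x ↦ by
    have := congr(Hom.app $w V x)
    exact this
  have ni : ∀ x, r M (iT x) = iV (r K x) := fun x ↦
    (congr($((modulesSpecToSheaf.map i).hom.naturality V.leTop.op).hom x)).symm
  have ng : ∀ x, r N (gT x) = gV (r M x) := fun x ↦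
    (congr($((modulesSpecToSheaf.map g).hom.naturality V.leTop.op).hom x)).symm
  change IsLocalizedModule.Away f (r K)
  refine IsLocalizedModule.Away.mk_of_addCommGroup ?_ ?_ ?_
  · exact Scheme.Modules.isUnit_algebraMap_end_of_le_basicOpen f le_rfl
  · intro x
    obtain ⟨⟨t, ⟨_, n, rfl⟩⟩, ht⟩ := IsLocalizedModule.surj (.powers f) (r M) (iV x)
    change f ^ n • iV x = r M t at ht
    have h0 : r N (gT t) = 0 := by rw [ng, ← ht, LinearMap.map_smul, hw, smul_zero]
    obtain ⟨⟨_, m, rfl⟩, hm⟩ := (IsLocalizedModule.eq_zero_iff (.powers f) (r N)).mp h0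
    change f ^ m • gT t = 0 at hm
    obtain ⟨y, hy⟩ := hgT (f ^ m • t) (by rw [LinearMap.map_smul, hm])
    refine ⟨m + n, y, hiV ?_⟩
    rw [← ni, hy, LinearMap.map_smul, LinearMap.map_smul, ← ht, smul_smul, pow_add]
  · intro x hx
    have h0 : r M (iT x) = 0 := by rw [ni, hx, map_zero]
    obtain ⟨⟨_, m, rfl⟩, hm⟩ := (IsLocalizedModule.eq_zero_iff (.powers f) (r M)).mp h0
    change f ^ m • iT x = 0 at hm
    exact ⟨m, hiT (by rw [LinearMap.map_smul, hm, map_zero])⟩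

lemma Modules.nonempty_presentation {R : CommRingCat.{u}} (M : (Spec R).Modules)
    [hM : M.IsQuasicoherent] : Nonempty M.Presentation :=
  have h : IsIso M.fromTildeΓ := isIso_fromTildeΓ_of_isQuasicoherent M
  have : @IsIso (SheafOfModules.{u} (Spec R).ringCatSheaf) _ _ _ M.fromTildeΓ := h
  ⟨SheafOfModules.Presentation.ofIsIso.{u, u, u} M.fromTildeΓ
    (presentationTilde.{u} _ .univ (by simp) _ (Submodule.span_eq _))⟩

lemma Modules.isQuasicoherent_iff_affine (M : X.Modules) :
    M.IsQuasicoherent ↔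
      ∀ (U : X.Opens) (hU : IsAffineOpen U), (M.restrict hU.fromSpec).IsQuasicoherent := by
  refine ⟨fun _ U hU ↦ inferInstance, fun h ↦ M.isQuasicoherent_of_cover fun x ↦ ?_⟩
  obtain ⟨U, hU, hx, -⟩ := exists_isAffineOpen_mem_and_subset (x := x) (U := ⊤) trivial
  have := h U hU
  obtain ⟨P⟩ := (M.restrict hU.fromSpec).nonempty_presentation
  refine ⟨U, hx, ⟨?_⟩⟩
  let e : (M.restrict hU.fromSpec).restrict hU.isoSpec.hom ≅ M.restrict U.ι :=
    ((restrictFunctorComp _ _).symm ≪≫ restrictFunctorCongr hU.isoSpec_hom_fromSpec).app M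
  have h : IsIso e.hom := inferInstance
  have : @IsIso (SheafOfModules.{u} U.toScheme.ringCatSheaf) _ _ _ e.hom := h
  exact SheafOfModules.Presentation.ofIsIso.{u, u, u} e.hom (presentationRestrict hU.isoSpec.hom P)

instance : X.isQcoh.IsClosedUnderIsomorphisms :=
  inferInstanceAs (SheafOfModules.isQuasicoherent X.ringCatSheaf).IsClosedUnderIsomorphisms

lemma Modules.isQuasicoherent_tilde_iff {R : CommRingCat.{u}} (M : (Spec R).Modules) :
    M.IsQuasicoherent ↔ (tilde.functor R).essImage M := by
  rw [isQuasicoherent_iff_isIso_fromTildeΓ, isIso_fromTildeΓ_iff]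

lemma Modules.isQuasicoherent_cokernel {R : CommRingCat.{u}} {M N : (Spec R).Modules} (g : M ⟶ N)
    [hM : M.IsQuasicoherent] [hN : N.IsQuasicoherent] : (cokernel g).IsQuasicoherent := by
  rw [isQuasicoherent_tilde_iff] at hM hN ⊢
  obtain ⟨A, ⟨a⟩⟩ := hM
  obtain ⟨B, ⟨b⟩⟩ := hN
  let f := (tilde.functor R).preimage (a.hom ≫ g ≫ b.inv)
  exact ⟨cokernel f, ⟨PreservesCokernel.iso (tilde.functor R) f ≪≫
    cokernel.mapIso _ _ a b (by rw [(tilde.functor R).map_preimage]; simp)⟩⟩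

lemma Modules.isQuasicoherent_biprod {R : CommRingCat.{u}} {M N : (Spec R).Modules}
    [hM : M.IsQuasicoherent] [hN : N.IsQuasicoherent] : (M ⊞ N).IsQuasicoherent := by
  rw [isQuasicoherent_tilde_iff] at hM hN ⊢
  obtain ⟨A, ⟨a⟩⟩ := hM
  obtain ⟨B, ⟨b⟩⟩ := hN
  have : PreservesBinaryBiproduct A B (tilde.functor R) :=
    preservesBinaryBiproduct_of_preservesBinaryCoproduct _
  exact ⟨A ⊞ B, ⟨(tilde.functor R).mapBiprod A B ≪≫ biprod.mapIso a b⟩⟩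

lemma Modules.isQuasicoherent_cokernel' {M N : X.Modules} (g : M ⟶ N)
    [hM : M.IsQuasicoherent] [hN : N.IsQuasicoherent] : (cokernel g).IsQuasicoherent := by
  rw [isQuasicoherent_iff_affine]
  intro U hU
  have h : (cokernel ((restrictFunctor hU.fromSpec).map g)).IsQuasicoherent :=
    isQuasicoherent_cokernel _
  exact (isQcoh _).prop_of_iso (PreservesCokernel.iso (restrictFunctor hU.fromSpec) g).symm h

lemma Modules.isQuasicoherent_biprod' {M N : X.Modules}
    [hM : M.IsQuasicoherent] [hN : N.IsQuasicoherent] : (M ⊞ N).IsQuasicoherent := by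
  rw [isQuasicoherent_iff_affine]
  intro U hU
  have : (restrictFunctor hU.fromSpec).PreservesZeroMorphisms := inferInstance
  have : PreservesBinaryBiproduct M N (restrictFunctor hU.fromSpec) :=
    preservesBinaryBiproduct_of_preservesBinaryCoproduct _
  have h : (M.restrict hU.fromSpec ⊞ N.restrict hU.fromSpec).IsQuasicoherent :=
    isQuasicoherent_biprod
  exact (isQcoh _).prop_of_iso ((restrictFunctor hU.fromSpec).mapBiprod M N).symm h

lemma Modules.isQuasicoherent_of_kernel {K M N : X.Modules} (i : K ⟶ M) (g : M ⟶ N)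
    (w : i ≫ g = 0) (h : IsLimit (KernelFork.ofι i w))
    [hM : M.IsQuasicoherent] [hN : N.IsQuasicoherent] : K.IsQuasicoherent := by
  rw [isQuasicoherent_iff_affine]
  intro U hU
  refine isQuasicoherent_of_sectionwise_kernel ((restrictFunctor hU.fromSpec).map i)
    ((restrictFunctor hU.fromSpec).map g) (by rw [← Functor.map_comp, w, Functor.map_zero])
    fun V ↦ ?_
  exact kernel_sections i g w h (hU.fromSpec ''ᵁ V)

instance : X.isQcoh.IsClosedUnderKernels where
  kernels_le := by
    rintro _ ⟨f, k, hk, ⟨hM, hN⟩⟩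
    exact Modules.isQuasicoherent_of_kernel k.ι f k.condition (hM := hM) (hN := hN)
      (hk.ofIsoLimit (Fork.ext (Iso.refl _) (by simp)))

instance : X.isQcoh.IsClosedUnderCokernels where
  cokernels_le := by
    rintro _ ⟨f, k, hk, ⟨hM, hN⟩⟩
    exact X.isQcoh.prop_of_iso ((cokernelIsCokernel f).coconePointUniqueUpToIso hk)
      (Modules.isQuasicoherent_cokernel' f (hM := hM) (hN := hN))

instance : X.isQcoh.ContainsZero where
  exists_zero := by
    refine ⟨0, isZero_zero _, (Modules.isQuasicoherent_iff_affine _).2 fun U hU ↦ ?_⟩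
    rw [Modules.isQuasicoherent_tilde_iff]
    exact ⟨0, ⟨((tilde.functor _).map_isZero (isZero_zero _)).iso
      ((Modules.restrictFunctor hU.fromSpec).map_isZero (isZero_zero _))⟩⟩

instance : X.isQcoh.IsClosedUnderFiniteProducts := by
  have : X.isQcoh.IsClosedUnderBinaryProducts := ⟨by
    rintro M ⟨p⟩
    exact X.isQcoh.prop_of_iso (IsLimit.conePointsIsoOfNatIso
      (BinaryBiproduct.isLimit _ _) p.isLimit (diagramIsoPair p.diag).symm)
      (Modules.isQuasicoherent_biprod' (hM := p.prop_diag_obj _) (hN := p.prop_diag_obj _))⟩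
  exact .mk'

/-- `Qcoh(X)` is abelian, as a full subcategory of `𝒪_X`-modules closed under kernels, cokernels
and finite products. -/
noncomputable instance : Abelian X.Qcoh := inferInstance

end AlgebraicGeometry.Scheme

/-! ## The loop category and the affine line -/

/-- The loop category: one object, whose endomorphism monoid is `(ℕ, +)`. -/
def Loop : Type u := PUnit.{u + 1}

instance : SmallCategory Loop.{u} where
  Hom _ _ := ULift.{u} ℕ
  id _ := ⟨0⟩
  comp m n := ⟨m.down + n.down⟩
  id_comp _ := ULift.ext _ _ (Nat.zero_add _)
  comp_id _ := ULift.ext _ _ (Nat.add_zero _)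
  assoc _ _ _ := ULift.ext _ _ (Nat.add_assoc _ _ _)

namespace AlgebraicGeometry.Scheme

noncomputable section
variable {X : Scheme.{u}}

/-- Multiplication by a global function `r`, as an endomorphism of an `𝒪_X`-module. -/
def Modules.mulBy (M : X.Modules) (r : Γ(X, ⊤)) : M ⟶ M where
  val := PresheafOfModules.homMk
    { app U := M.smul (X.presheaf.map (homOfLE le_top : U.unop ⟶ ⊤).op r)
      naturality U V i := by
        have := Modules.map_comp_smul (M := M) i.unop (X.presheaf.map (homOfLE le_top : U.unop ⟶ ⊤).op r)
        rw [← CategoryTheory.comp_apply, ← Functor.map_comp] at this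
        exact this.symm }
    (fun U s m ↦ smul_comm (X.presheaf.map (homOfLE le_top : U.unop ⟶ ⊤).op r)
      (show Γ(X, U.unop) from s) (show Γ(M, U.unop) from m))

lemma Modules.mulBy_app (M : X.Modules) (r : Γ(X, ⊤)) (U : X.Opens) (m : Γ(M, U)) :
    (M.mulBy r).app U m = X.presheaf.map (homOfLE le_top : U ⟶ ⊤).op r • m := rfl

lemma Modules.mulBy_one (M : X.Modules) : M.mulBy 1 = 𝟙 M := by
  ext U m
  rw [mulBy_app, map_one, one_smul]; rfl

lemma Modules.mulBy_mul (M : X.Modules) (r s : Γ(X, ⊤)) :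
    M.mulBy (r * s) = M.mulBy r ≫ M.mulBy s := by
  ext U m
  rw [mulBy_app, map_mul, mul_comm, mul_smul]; rfl

lemma Modules.mulBy_naturality {M N : X.Modules} (f : M ⟶ N) (r : Γ(X, ⊤)) :
    M.mulBy r ≫ f = f ≫ N.mulBy r := by
  ext U m
  exact Hom.app_smul f _ m

variable (X) in
/-- The affine line `𝔸¹_X`. -/
abbrev affineLine : Scheme.{u} := 𝔸(PUnit.{u + 1}; X)

variable (X) in
/-- The coordinate function of the affine line. -/
def affineLine.T : Γ(X.affineLine, ⊤) := AffineSpace.coord X PUnit.unit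

variable (X) in
/-- The functor that sends an `𝒪`-module `M` on the affine line, with projection `π : 𝔸¹_X ⟶ X`,
to the `Loop`-shaped diagram `π_* M` on which `n : • ⟶ •` acts as multiplication by `T ^ n`. -/
def pushforwardLoop : X.affineLine.Modules ⥤ (Loop.{u} ⥤ X.Modules) where
  obj M :=
    { obj _ := (Modules.pushforward (X.affineLine ↘ X)).obj M
      map n := (Modules.pushforward (X.affineLine ↘ X)).map (M.mulBy (affineLine.T X ^ n.down))
      map_id _ := by
        change (Modules.pushforward (X.affineLine ↘ X)).map (M.mulBy (affineLine.T X ^ 0)) = _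
        rw [pow_zero, Modules.mulBy_one, CategoryTheory.Functor.map_id]
      map_comp m n := by
        change (Modules.pushforward (X.affineLine ↘ X)).map (M.mulBy (affineLine.T X ^ (m.down + n.down))) = _
        rw [pow_add, Modules.mulBy_mul, Functor.map_comp] }
  map f :=
    { app _ := (Modules.pushforward (X.affineLine ↘ X)).map f
      naturality _ _ n := by
        dsimp only
        rw [← Functor.map_comp, ← Functor.map_comp, Modules.mulBy_naturality] }

end
end AlgebraicGeometry.Scheme

/-! ## Prederivators -/

section

open Bicategory Bicategory.Opposite

lemma unop2_eqToHom {B : Type*} [Bicategory B] {a b : Bᵒᵖ} {f g : a ⟶ b} (h : f = g) :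
   (eqToHom h).unop2 = eqToHom (congrArg Quiver.Hom.unop h) := by
  subst h; rfl

lemma hom2_ext {B : Type*} [Bicategory B] {a b : Bᵒᵖ} {f g : a ⟶ b} {η θ : f ⟶ g}
    (h : η.unop2 = θ.unop2) : η = θ :=
  congrArg Hom2.op2' h

instance {B : Type*} [Bicategory B] [Bicategory.Strict B] : Bicategory.Strict Bᵒᵖ where
  id_comp f := by apply Quiver.Hom.unop_inj; exact Strict.comp_id f.unop
  comp_id f := by apply Quiver.Hom.unop_inj; exact Strict.id_comp f.unop
  assoc f g h := by apply Quiver.Hom.unop_inj; exact (Strict.assoc h.unop g.unop f.unop).symm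
  leftUnitor_eqToIso f := by
    ext
    apply hom2_ext
    rw [eqToIso.hom, unop2_eqToHom, bicategory_leftUnitor_hom_unop2, Strict.rightUnitor_eqToIso]; rfl
  rightUnitor_eqToIso f := by
    ext
    apply hom2_ext
    rw [eqToIso.hom, unop2_eqToHom, bicategory_rightUnitor_hom_unop2, Strict.leftUnitor_eqToIso]; rfl
  associator_eqToIso f g h := by
    ext
    apply hom2_ext
    rw [eqToIso.hom, unop2_eqToHom, bicategory_associator_hom_unop2, Strict.associator_eqToIso]; rfl

lemma hom2_eq_conj {B : Type*} [Bicategory B] {a b : Bᵒᵖ} {f f' g g' : a ⟶ b} (h : f = f')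
    (h' : g' = g) (η : f ⟶ g) (θ : f' ⟶ g')
    (H : η.unop2 = eqToHom (congrArg Quiver.Hom.unop h) ≫ θ.unop2 ≫
      eqToHom (congrArg Quiver.Hom.unop h')) :
    η = eqToHom h ≫ θ ≫ eqToHom h' := by
  subst h h'
  simp only [eqToHom_refl, Category.id_comp, Category.comp_id] at H ⊢
  exact hom2_ext H

lemma cat_hom₂_eq_conj {C D : Cat.{v, w}} {F F' G G' : C ⟶ D} (h : F = F') (h' : G' = G)
    (α : F ⟶ G) (β : F' ⟶ G')
    (H : ∀ x, HEq (α.toNatTrans.app x) (β.toNatTrans.app x)) :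
    α = eqToHom h ≫ β ≫ eqToHom h' := by
  subst h h'
  simp only [eqToHom_refl, Category.id_comp, Category.comp_id]
  ext x
  exact eq_of_heq (H x)

/-- A prederivator: a strict 2-functor from small categories to (large) categories that reverses the
direction of functors and keeps the direction of natural transformations (`ᵒᵖ` is the dual
bicategory with reversed 1-cells). -/
abbrev Prederivator := StrictPseudofunctor (Cat.{u, u})ᵒᵖ Cat.{u + 1, u + 1}

namespace Prederivator
noncomputable section

/-- The strict 2-functor `I ↦ L × I` on small categories. -/
def prodLeft (L : Cat.{u, u}) : StrictPseudofunctor (Cat.{u, u})ᵒᵖ (Cat.{u, u})ᵒᵖ :=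
  StrictPseudofunctor.mk''
    { obj I := op (Cat.of (L × I.unop))
      map F := (Functor.prod (𝟭 L) F.unop.toFunctor).toCatHom.op
      map₂ α := op2 (NatTrans.prod (𝟙 (𝟭 L)) α.unop2.toNatTrans).toCatHom₂
      map₂_id _ := by
        apply hom2_ext
        ext; rfl
      map₂_comp _ _ := by
        apply hom2_ext
        ext x
        · exact Prod.ext (Category.comp_id _).symm rfl
      map₂_whisker_left _ _ _ _ := hom2_eq_conj _ _ _ _ (cat_hom₂_eq_conj _ _ _ _ fun _ ↦ HEq.rfl)
      map₂_whisker_right _ _ := hom2_eq_conj _ _ _ _ (cat_hom₂_eq_conj _ _ _ _ fun _ ↦ HEq.rfl) }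

/-- The prederivator `D` shifted by `L`: `D^L = D ∘ (L × -)`, so that `D^L(I) = D(L × I)`. -/
def shift (D : Prederivator.{u}) (L : Cat.{u, u}) : Prederivator.{u} := (prodLeft L).comp D

section derived
variable {A : Type w} [Category.{v} A] [Abelian A] {B : Type w} [Category.{v} B] [Abelian B]

variable (A) in
/-- The derived category `D(A)`: cochain complexes localized at the quasi-isomorphisms. -/
abbrev Derived : Type (max w v) := (HomologicalComplex.quasiIso A (ComplexShape.up ℤ)).Localization

variable (A) in
/-- The localization functor `Ch(A) ⥤ D(A)`. -/
abbrev Derived.Q : CochainComplex A ℤ ⥤ Derived A :=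
  (HomologicalComplex.quasiIso A (ComplexShape.up ℤ)).Q

/-- The functor between derived categories induced by an exact functor. -/
def Derived.map (F : A ⥤ B) [F.Additive] [F.PreservesHomology] : Derived A ⥤ Derived B :=
  Localization.Construction.lift (F.mapHomologicalComplex (ComplexShape.up ℤ) ⋙ Derived.Q B)
    fun _ _ f (_ : QuasiIso f) ↦
     Localization.Construction.wIso ((F.mapHomologicalComplex (ComplexShape.up ℤ)).map f)
       (HomologicalComplex.quasiIso_map_of_preservesHomology f F) |>.isIso_hom

lemma Derived.Q_map (F : A ⥤ B) [F.Additive] [F.PreservesHomology] :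
    Derived.Q A ⋙ Derived.map F = F.mapHomologicalComplex (ComplexShape.up ℤ) ⋙ Derived.Q B :=
  Localization.Construction.fac _ _

lemma Derived.map_Q_map (F : A ⥤ B) [F.Additive] [F.PreservesHomology]
    {K L : CochainComplex A ℤ} (f : K ⟶ L) :
    (Derived.map F).map ((Derived.Q A).map f) =
      (Derived.Q B).map ((F.mapHomologicalComplex (ComplexShape.up ℤ)).map f) :=
  (Functor.congr_hom (Derived.Q_map F) f).trans
    ((Category.id_comp _).trans (Category.comp_id _))

/-- The natural transformation between derived functors induced by a natural transformation
between exact functors. -/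
def Derived.map₂ {F G : A ⥤ B} [F.Additive] [F.PreservesHomology] [G.Additive]
    [G.PreservesHomology] (α : F ⟶ G) : Derived.map F ⟶ Derived.map G :=
  Localization.Construction.natTransExtension
    (eqToHom (Derived.Q_map F) ≫
      Functor.whiskerRight (NatTrans.mapHomologicalComplex α (ComplexShape.up ℤ)) (Derived.Q B) ≫
      eqToHom (Derived.Q_map G).symm)

lemma Derived.map₂_app {F G : A ⥤ B} [F.Additive] [F.PreservesHomology] [G.Additive]
    [G.PreservesHomology] (α : F ⟶ G) (K : CochainComplex A ℤ) :
    (Derived.map₂ α).app ((Derived.Q A).obj K) =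
      (Derived.Q B).map ((NatTrans.mapHomologicalComplex α (ComplexShape.up ℤ)).app K) := by
  rw [Derived.map₂, Localization.Construction.natTransExtension_app,
    Localization.Construction.NatTransExtension.app_eq]
  simp only [NatTrans.comp_app, CategoryTheory.eqToHom_app]
  exact (Category.id_comp _).trans (Category.comp_id _)

lemma Derived.map₂_ext {F G : Derived A ⥤ Derived B} {α β : F ⟶ G}
    (h : ∀ K, α.app ((Derived.Q A).obj K) = β.app ((Derived.Q A).obj K)) : α = β := by
  ext X
  obtain ⟨K, rfl⟩ := (Localization.Construction.objEquiv _).surjective X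
  exact h K

end derived

/-- The prederivator `I ↦ D(A^I)` of an abelian category `A`, with restriction along `u : I ⥤ J`
induced by precomposition `A^J ⥤ A^I`. -/
def ofAbelian (A : Type (u + 1)) [Category.{u} A] [Abelian A] : Prederivator.{u} :=
  StrictPseudofunctor.mk''
    { obj I := Cat.of (Derived (I.unop ⥤ A))
      map F := (Derived.map ((Functor.whiskeringLeft _ _ A).obj F.unop.toFunctor)).toCatHom
      map₂ α := (Derived.map₂ ((Functor.whiskeringLeft _ _ A).map α.unop2.toNatTrans)).toCatHom₂
      map_id I := by
        ext : 1
        refine Localization.Construction.uniq _ _ ?_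
        exact Derived.Q_map _
      map_comp F G := by
        ext : 1
        refine Localization.Construction.uniq _ _ ?_
        refine (Derived.Q_map _).trans ?_
        change _ = Derived.Q _ ⋙ (Derived.map _ ⋙ Derived.map _)
        rw [← Functor.assoc, Derived.Q_map, Functor.assoc, Derived.Q_map]
        rfl
      map₂_id F := by
        ext : 1
        refine Derived.map₂_ext fun K ↦ ?_
        refine (Derived.map₂_app _ _).trans ?_
        refine (congrArg (Derived.Q (_ ⥤ A)).map ?_).trans
          (CategoryTheory.Functor.map_id (Derived.Q (_ ⥤ A)) _)
        ext n i
        exact (K.X n).map_id _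
      map₂_comp α β := by
        ext : 1
        refine Derived.map₂_ext fun K ↦ ?_
        refine (Derived.map₂_app _ _).trans ?_
        refine Eq.trans ?_ (congrArg₂ (· ≫ ·) (Derived.map₂_app _ _) (Derived.map₂_app _ _)).symm
        refine (congrArg (Derived.Q (_ ⥤ A)).map ?_).trans ((Derived.Q (_ ⥤ A)).map_comp _ _)
        ext n i
        exact (K.X n).map_comp _ _
      map₂_whisker_left F _ _ α := cat_hom₂_eq_conj _ _ _ _ fun X ↦ by
        obtain ⟨K, rfl⟩ := (Localization.Construction.objEquiv _).surjective X
        refine (heq_of_eq (Derived.map₂_app _ _)).trans ?_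
        exact (heq_of_eq (Derived.map₂_app
          (F := (Functor.whiskeringLeft _ _ A).obj _) (G := (Functor.whiskeringLeft _ _ A).obj _)
          ((Functor.whiskeringLeft _ _ A).map α.unop2.toNatTrans)
          ((((Functor.whiskeringLeft _ _ A).obj F.unop.toFunctor).mapHomologicalComplex _).obj
            K))).symm
      map₂_whisker_right α F := cat_hom₂_eq_conj _ _ _ _ fun X ↦ by
        obtain ⟨K, rfl⟩ := (Localization.Construction.objEquiv _).surjective X
        refine (heq_of_eq (Derived.map₂_app _ _)).trans ?_
        refine HEq.trans ?_ (heq_of_eq (congrArg (Derived.map ((Functor.whiskeringLeft _ _ A).obj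
          F.unop.toFunctor)).map (Derived.map₂_app
            ((Functor.whiskeringLeft _ _ A).map α.unop2.toNatTrans) K).symm))
        exact (heq_of_eq (Derived.map_Q_map ((Functor.whiskeringLeft _ _ A).obj F.unop.toFunctor)
          ((NatTrans.mapHomologicalComplex ((Functor.whiskeringLeft _ _ A).map
            α.unop2.toNatTrans) (ComplexShape.up ℤ)).app K))).symm }

open scoped Pseudofunctor.StrongTrans

/-- An equivalence of prederivators in the strict sense: strict 2-natural transformations in both
directions, whose composites are isomorphic to the identities by invertible modifications. -/
structure StrongEquivalence (D E : Prederivator.{u}) where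
  /-- The underlying equivalence in the bicategory of pseudofunctors. -/
  equiv : Bicategory.Equivalence D.toPseudofunctor E.toPseudofunctor
  /-- The naturality squares of the forward transformation commute strictly. -/
  hom_strict {I J : (Cat.{u, u})ᵒᵖ} (F : I ⟶ J) : ∃ h, equiv.hom.naturality F = eqToIso h
  /-- The naturality squares of the backward transformation commute strictly. -/
  inv_strict {I J : (Cat.{u, u})ᵒᵖ} (F : I ⟶ J) : ∃ h, equiv.inv.naturality F = eqToIso h

/-- The component at `I` of a strict equivalence of prederivators. -/
def StrongEquivalence.functor {D E : Prederivator.{u}} (Φ : StrongEquivalence D E)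
    (I : Cat.{u, u}) : D.obj (op I) ⥤ E.obj (op I) :=
  (Φ.equiv.hom.app (op I)).toFunctor

section diagrams

variable {A : Type (u + 1)} [Category.{u} A] {B : Type (u + 1)} [Category.{u} B]
  {L : Type u} [Category.{u} L]

/-- The functor `A^I ⥤ B^(L × I)` induced by `G : A ⥤ B^L`, sending `F` to
`(l, i) ↦ G (F i) l`. -/
def diagrams (G : A ⥤ (L ⥤ B)) (I : Type u) [Category.{u} I] : (I ⥤ A) ⥤ (L × I ⥤ B) :=
  (Functor.whiskeringRight I A (L ⥤ B)).obj G ⋙ flipFunctor I L B ⋙ Functor.uncurry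

instance [HasZeroMorphisms A] [HasZeroMorphisms B] (G : A ⥤ (L ⥤ B)) [G.PreservesZeroMorphisms]
    (I : Type u) [Category.{u} I] : (diagrams G I).PreservesZeroMorphisms where
  map_zero F F' := by
    ext ⟨l, i⟩
    exact congrArg (fun f ↦ NatTrans.app f l) (G.map_zero (F.obj i) (F'.obj i))

end diagrams

end

end Prederivator

end

/-- The prederivator `D_X` of a scheme, `D_X(I) = D(Qcoh(X)^I)`. -/
noncomputable def AlgebraicGeometry.Scheme.derivator (X : Scheme.{u}) : Prederivator.{u} :=
  Prederivator.ofAbelian X.Qcoh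

/-!
A quasi-coherent module `M` on `X` with an endomorphism `t` has a universal module `P` on the affine
line: the cokernel of `π^* t - T` on `π^* M`. Over an affine open `U ⊆ X`, functions on `π⁻¹ U` are
polynomials over `Γ(X, U)`, so `Γ(M, U)` becomes a module over them with `T` acting as `t`, and
hence defines a quasi-coherent module on `π⁻¹ U`. Both this local model and `P` corepresent the same
functor on the modules that are direct images from `π⁻¹ U`, so they agree over `π⁻¹ U`. Therefore
`P` is quasi-coherent and `M ⟶ π_* P` is an isomorphism. As `e` is faithful and reflects
isomorphisms, this together with the universal property of `P` makes it an equivalence.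

For prederivators, an equivalence of abelian categories acts on complexes by functors that commute
strictly with restriction of diagrams, and its unit and counit are natural in the diagram. The
isomorphism of categories `(B^L)^I ≅ B^(L × I)` is strictly natural in `I`, so it passes to derived
categories with strictly natural inverses. The strong equivalence is the composite of the two.
-/

/-! ## Sections of quasi-coherent modules -/

section Sections

open AlgebraicGeometry.Scheme TopologicalSpace

variable {X Y : Scheme.{u}}

/-- Restriction of the sections of a module to a smaller open. -/
noncomputable abbrev restrictSection (M : X.Modules) {U V : X.Opens} (h : V ≤ U) (s : Γ(M, U)) :
    Γ(M, V) :=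
  M.presheaf.map (homOfLE h).op s

/-- Restriction of functions to a smaller open. -/
noncomputable abbrev restrictFunction {U V : X.Opens} (h : V ≤ U) (r : Γ(X, U)) : Γ(X, V) :=
  X.presheaf.map (homOfLE h).op r

lemma app_restrictSection {M N : X.Modules} (f : M ⟶ N) {U V : X.Opens} (h : V ≤ U)
    (s : Γ(M, U)) : f.app V (restrictSection M h s) = restrictSection N h (f.app U s) :=
  congr($(f.mapPresheaf.naturality (homOfLE h).op) s)

lemma section_ext {M : X.Modules} {W : X.Opens} {s t : Γ(M, W)}
    (h : ∀ x ∈ W, ∃ (V : X.Opens) (hV : V ≤ W), x ∈ V ∧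
      restrictSection M hV s = restrictSection M hV t) : s = t := by
  refine TopCat.Presheaf.IsSheaf.section_ext M.isSheaf fun x hx ↦ ?_
  obtain ⟨V, hV, hxV, hst⟩ := h x hx
  exact ⟨V, hV, hxV, hst⟩

lemma bijective_restrictSection_of_eq (M : X.Modules) {U V : X.Opens} (h : V ≤ U) (hUV : V = U) :
    Function.Bijective (restrictSection M h) := by
  subst hUV
  have : restrictSection M h = id :=
    funext fun s ↦ congr($(CategoryTheory.Functor.map_id M.presheaf _) s)
  exact this ▸ Function.bijective_id

lemma isUnit_restrictFunction_basicOpen {U : X.Opens} (r : Γ(X, U)) :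
    IsUnit (restrictFunction (X.basicOpen_le r) r) :=
  RingedSpace.isUnit_res_basicOpen X.toRingedSpace r

lemma app_eq_of_locally {M N : X.Modules} {f g : M ⟶ N} {W : X.Opens}
    (h : ∀ x ∈ W, ∃ V ≤ W, x ∈ V ∧ ∀ s, f.app V s = g.app V s) (s : Γ(M, W)) :
    f.app W s = g.app W s :=
  section_ext fun x hx ↦ by
    obtain ⟨V, hV, hxV, hfg⟩ := h x hx
    exact ⟨V, hV, hxV, by rw [← app_restrictSection, ← app_restrictSection, hfg]⟩

lemma isIso_of_bijective_app_affine {M N : X.Modules} {f : M ⟶ N}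
    (h : ∀ U, IsAffineOpen U → Function.Bijective (f.app U)) : IsIso f := by
  have hB : Opens.IsBasis (Set.range ((↑) : X.affineOpens → X.Opens)) := by
    rw [Subtype.range_coe]
    exact X.isBasis_affineOpens
  let F : TopCat.Sheaf Ab.{u} X := ⟨M.presheaf, M.isSheaf⟩
  let G : TopCat.Sheaf Ab.{u} X := ⟨N.presheaf, N.isSheaf⟩
  let φ : F ⟶ G := ⟨f.mapPresheaf⟩
  have : IsIso φ := TopCat.Sheaf.isIso_iff_isIso_basis hB fun U ↦
    (ConcreteCategory.isIso_iff_bijective _).2 (h U U.2)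
  have : IsIso ((Modules.toPresheaf X).map f) :=
    Functor.map_isIso (TopCat.Sheaf.forget Ab.{u} X) φ
  exact isIso_of_reflects_iso f (Modules.toPresheaf X)

end Sections

section Localizing

open AlgebraicGeometry.Scheme TopologicalSpace

variable {X Y : Scheme.{u}}

/-- The restriction map `Γ(M, U) → Γ(M, V)` exhibits its target as the localization at
`f ∈ Γ(X, U)`, provided that `f` is invertible on `V`: it is surjective and injective up to powers
of `f`. -/
def IsLocalizedRestriction (M : X.Modules) {U V : X.Opens} (h : V ≤ U) (f : Γ(X, U)) : Prop :=
  (∀ s : Γ(M, V), ∃ (n : ℕ) (t : Γ(M, U)),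
      restrictSection M h t = restrictFunction h f ^ n • s) ∧
    ∀ t : Γ(M, U), restrictSection M h t = 0 → ∃ n : ℕ, f ^ n • t = 0

/-- The sections of `M` over `D(f) ⊆ U` are the localization at `f` of the sections over `U`, for
every function `f` on `U`. When `U` is affine, this says that `M` is quasi-coherent over `U`. -/
def IsLocalizingOver (M : X.Modules) (U : X.Opens) : Prop :=
  ∀ f : Γ(X, U), IsLocalizedRestriction M (X.basicOpen_le f) f

lemma isLocalizedRestriction_iff_of_eq (M : X.Modules) {U V V' : X.Opens} (h : V ≤ U)
    (hV : V' = V) (f : Γ(X, U)) :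
    IsLocalizedRestriction M h f ↔ IsLocalizedRestriction M (hV.trans_le h) f := by
  subst hV; rfl

lemma isLocalizedRestriction_restrict_iff (M : X.Modules) (j : Y ⟶ X) [IsOpenImmersion j]
    {U V : Y.Opens} (h : V ≤ U) (f : Γ(Y, U)) :
    IsLocalizedRestriction (M.restrict j) h f ↔
      IsLocalizedRestriction M (j.image_mono h) ((j.appIso U).inv f) := by
  have hV (n : ℕ) (s : Γ(M, j ''ᵁ V)) :
      (j.appIso V).inv (restrictFunction h f ^ n) • s =
        restrictFunction (j.image_mono h) ((j.appIso U).inv f) ^ n • s := by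
    have := congr($(j.appIso_inv_naturality (homOfLE h).op) f)
    rw [map_pow]
    exact congrArg (fun r : Γ(X, j ''ᵁ V) ↦ r ^ n • s) this
  have hU (n : ℕ) (t : Γ(M, j ''ᵁ U)) :
      (j.appIso U).inv (f ^ n) • t = (j.appIso U).inv f ^ n • t := by
    rw [map_pow]
  exact and_congr
    (forall_congr' fun s ↦ exists_congr fun n ↦ exists_congr fun t ↦ Eq.congr_right (hV n s))
    (forall_congr' fun t ↦ imp_congr_right fun _ ↦ exists_congr fun n ↦ Eq.congr_left (hU n t))

lemma isLocalizedRestriction_pushforward_iff (π : Y ⟶ X) (M : Y.Modules) {U V : X.Opens}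
    (h : V ≤ U) (f : Γ(X, U)) :
    IsLocalizedRestriction ((Modules.pushforward π).obj M) h f ↔
      IsLocalizedRestriction M (π.preimage_mono h) (π.app U f) := by
  have hV (n : ℕ) (s : Γ(M, π ⁻¹ᵁ V)) :
      π.app V (restrictFunction h f ^ n) • s =
        restrictFunction (π.preimage_mono h) (π.app U f) ^ n • s := by
    rw [map_pow]
    exact congr(($(π.naturality (homOfLE h).op) f) ^ n • s)
  have hU (n : ℕ) (t : Γ(M, π ⁻¹ᵁ U)) : π.app U (f ^ n) • t = π.app U f ^ n • t := by
    rw [map_pow]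
  exact and_congr
    (forall_congr' fun s ↦ exists_congr fun n ↦ exists_congr fun t ↦ Eq.congr_right (hV n s))
    (forall_congr' fun t ↦ imp_congr_right fun _ ↦ exists_congr fun n ↦ Eq.congr_left (hU n t))

lemma IsLocalizingOver.pushforward (π : Y ⟶ X) {M : Y.Modules} {U : X.Opens}
    (h : IsLocalizingOver M (π ⁻¹ᵁ U)) :
    IsLocalizingOver ((Modules.pushforward π).obj M) U := fun f ↦
  (isLocalizedRestriction_pushforward_iff π M _ f).2
    ((isLocalizedRestriction_iff_of_eq _ _ (preimage_basicOpen π f) _).1 (h (π.app U f)))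

lemma isLocalizedRestriction_iff_isLocalizedModule {R : CommRingCat.{u}} (M : (Spec R).Modules)
    (f : R) {V : (Spec R).Opens} (hV : V ≤ PrimeSpectrum.basicOpen f) :
    IsLocalizedRestriction M (le_top : V ≤ ⊤) ((ΓSpecIso R).inv f) ↔
      IsLocalizedModule.Away f ((modulesSpecToSheaf.obj M).obj.map V.leTop.op).hom := by
  let ρ : Γ(M, ⊤) →ₗ[R] Γ(M, V) := ((modulesSpecToSheaf.obj M).obj.map V.leTop.op).hom
  have hsmul (n : ℕ) (s : Γ(M, V)) :
      f ^ n • s = restrictFunction (le_top : V ≤ ⊤) ((ΓSpecIso R).inv f) ^ n • s := by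
    rw [Modules.smul_Spec_def, map_pow, map_pow]
    rfl
  have hsmul_top (n : ℕ) (s : Γ(M, ⊤)) : f ^ n • s = (ΓSpecIso R).inv f ^ n • s := by
    rw [Modules.smul_Spec_def, map_pow]
    exact congrArg (· • s) (congr($((Spec R).presheaf.map_id _) _))
  change _ ↔ IsLocalizedModule (.powers f) ρ
  refine ⟨fun h ↦ IsLocalizedModule.Away.mk_of_addCommGroup
    (Modules.isUnit_algebraMap_end_of_le_basicOpen f hV) (fun s ↦ ?_) fun t ht ↦ ?_,
    fun h ↦ ⟨fun s ↦ ?_, fun t ht ↦ ?_⟩⟩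
  · obtain ⟨n, t, ht⟩ := h.1 s
    exact ⟨n, t, (hsmul n s).trans ht.symm⟩
  · obtain ⟨n, hn⟩ := h.2 t ht
    exact ⟨n, (hsmul_top n t).trans hn⟩
  · obtain ⟨⟨t, ⟨_, n, rfl⟩⟩, ht⟩ := h.surj s
    exact ⟨n, t, ht.symm.trans (hsmul n s)⟩
  · obtain ⟨⟨_, n, rfl⟩, hn⟩ := (IsLocalizedModule.eq_zero_iff (.powers f) ρ).mp ht
    exact ⟨n, (hsmul_top n t).symm.trans hn⟩

lemma isQuasicoherent_iff_isLocalizingOver_top {R : CommRingCat.{u}} (M : (Spec R).Modules) :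
    M.IsQuasicoherent ↔ IsLocalizingOver M ⊤ := by
  rw [isQuasicoherent_iff_isIso_fromTildeΓ, isIso_fromTildeΓ_iff_isLocalizing]
  have hR : Function.Surjective (ΓSpecIso R).inv :=
    (ConcreteCategory.bijective_of_isIso (ΓSpecIso R).inv).2
  refine Iff.trans (forall_congr' fun f ↦ ?_) hR.forall.symm
  rw [isLocalizedRestriction_iff_of_eq M _ (basicOpen_eq_of_affine f).symm]
  exact (isLocalizedRestriction_iff_isLocalizedModule M f le_rfl).symm

lemma isQuasicoherent_restrict_iff {R : CommRingCat.{u}} (M : X.Modules) (j : Spec R ⟶ X)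
    [IsOpenImmersion j] : (M.restrict j).IsQuasicoherent ↔ IsLocalizingOver M (j ''ᵁ ⊤) := by
  have hj : Function.Surjective (j.appIso ⊤).inv :=
    (ConcreteCategory.bijective_of_isIso (j.appIso ⊤).inv).2
  rw [isQuasicoherent_iff_isLocalizingOver_top]
  refine Iff.trans (forall_congr' fun f ↦ ?_) hj.forall.symm
  rw [isLocalizedRestriction_restrict_iff]
  exact isLocalizedRestriction_iff_of_eq M _ (image_basicOpen j _).symm _

lemma isLocalizingOver_iff (M : X.Modules) {U : X.Opens} (hU : IsAffineOpen U) :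
    IsLocalizingOver M U ↔ (M.restrict hU.fromSpec).IsQuasicoherent := by
  rw [isQuasicoherent_restrict_iff, Hom.image_top_eq_opensRange, hU.opensRange_fromSpec]

lemma isLocalizingOver_of_isQuasicoherent (M : X.Modules) [M.IsQuasicoherent] {U : X.Opens}
    (hU : IsAffineOpen U) : IsLocalizingOver M U :=
  (isLocalizingOver_iff M hU).2 inferInstance

lemma isQuasicoherent_pushforward (π : Y ⟶ X) [IsAffineHom π] (M : Y.Modules)
    [M.IsQuasicoherent] : ((Modules.pushforward π).obj M).IsQuasicoherent :=
  (Modules.isQuasicoherent_iff_affine _).2 fun _ hU ↦ (isLocalizingOver_iff _ hU).1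
    (isLocalizingOver_of_isQuasicoherent M (hU.preimage π)).pushforward

lemma isQuasicoherent_of_locally_isLocalizingOver {M : X.Modules}
    (h : ∀ x, ∃ U, IsAffineOpen U ∧ x ∈ U ∧ IsLocalizingOver M U) : M.IsQuasicoherent := by
  refine M.isQuasicoherent_of_cover fun x ↦ ?_
  obtain ⟨U, hU, hx, hMU⟩ := h x
  have := (isLocalizingOver_iff M hU).1 hMU
  obtain ⟨P⟩ := (M.restrict hU.fromSpec).nonempty_presentation
  let e : (M.restrict hU.fromSpec).restrict hU.isoSpec.hom ≅ M.restrict U.ι :=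
    ((Modules.restrictFunctorComp _ _).symm ≪≫
      Modules.restrictFunctorCongr hU.isoSpec_hom_fromSpec).app M
  have : @IsIso (SheafOfModules.{u} U.toScheme.ringCatSheaf) _ _ _ e.hom :=
    inferInstanceAs (IsIso e.hom)
  exact ⟨U, hx, ⟨SheafOfModules.Presentation.ofIsIso.{u, u, u} e.hom
    (Modules.presentationRestrict hU.isoSpec.hom P)⟩⟩

lemma app_eq_of_isLocalizingOver {M N : X.Modules} {U : X.Opens} (hU : IsAffineOpen U)
    (hM : IsLocalizingOver M U) {f g : M ⟶ N} (hfg : ∀ s, f.app U s = g.app U s) {W : X.Opens}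
    (hW : W ≤ U) (s : Γ(M, W)) : f.app W s = g.app W s := by
  refine app_eq_of_locally (fun x hx ↦ ?_) s
  obtain ⟨r, hr, hxr⟩ := hU.exists_basicOpen_le ⟨x, hx⟩ (hW hx)
  refine ⟨_, hr, hxr, fun s ↦ ?_⟩
  obtain ⟨n, t, ht⟩ := (hM r).1 s
  rw [← ((isUnit_restrictFunction_basicOpen r).pow n).smul_left_cancel, ← Modules.Hom.app_smul,
    ← Modules.Hom.app_smul, ← ht, app_restrictSection, app_restrictSection, hfg]

end Localizing

section Extended

open AlgebraicGeometry.Scheme TopologicalSpace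

variable {X Y : Scheme.{u}}

/-- `N` is the direct image of its restriction to `U`. -/
def IsExtendedFrom (N : X.Modules) (U : X.Opens) : Prop :=
  ∀ W, Function.Bijective (restrictSection N (inf_le_left : W ⊓ U ≤ W))

lemma IsExtendedFrom.pushforward (π : Y ⟶ X) {N : Y.Modules} {U : X.Opens}
    (h : IsExtendedFrom N (π ⁻¹ᵁ U)) : IsExtendedFrom ((Modules.pushforward π).obj N) U :=
  fun W ↦ h (π ⁻¹ᵁ W)

lemma isExtendedFrom_pushforward (π : Y ⟶ X) (N : Y.Modules) {U : X.Opens} (hU : π ⁻¹ᵁ U = ⊤) :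
    IsExtendedFrom ((Modules.pushforward π).obj N) U :=
  fun W ↦ bijective_restrictSection_of_eq N _ (by
    rw [Hom.preimage_inf, hU, inf_top_eq])

lemma hom_ext_of_isExtendedFrom {M N : X.Modules} {U : X.Opens} (hU : IsAffineOpen U)
    (hM : IsLocalizingOver M U) (hN : IsExtendedFrom N U) {f g : M ⟶ N}
    (h : ∀ s, f.app U s = g.app U s) : f = g := by
  ext W s
  apply (hN W).1
  rw [← app_restrictSection, ← app_restrictSection]
  exact app_eq_of_isLocalizingOver hU hM h inf_le_right _

section OpenImmersion

variable (j : Y ⟶ X) [IsOpenImmersion j]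

lemma isIso_restrictAdjunction_unit_app {N : X.Modules} (hN : IsExtendedFrom N (j ''ᵁ ⊤)) :
    IsIso ((Modules.restrictAdjunction j).unit.app N) := by
  rw [Modules.Hom.isIso_iff_isIso_app]
  intro W
  rw [ConcreteCategory.isIso_iff_bijective, Modules.restrictAdjunction_unit_app_app]
  have hW : j ''ᵁ j ⁻¹ᵁ W = W ⊓ j ''ᵁ ⊤ := by
    rw [j.image_preimage_eq_opensRange_inf, inf_comm, j.image_top_eq_opensRange]
  have key (V : X.Opens) (hV : V = W ⊓ j ''ᵁ ⊤) (h : V ≤ W) :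
      Function.Bijective (restrictSection N h) := by
    subst hV
    exact hN W
  exact key _ hW _

lemma exists_restrictFunctor_map_eq {M N : X.Modules} (hN : IsExtendedFrom N (j ''ᵁ ⊤))
    (g : M.restrict j ⟶ N.restrict j) : ∃ f : M ⟶ N, (Modules.restrictFunctor j).map f = g := by
  have := isIso_restrictAdjunction_unit_app j hN
  let adj := Modules.restrictAdjunction j
  refine ⟨adj.homEquiv M _ g ≫ inv (adj.unit.app N), (adj.homEquiv M _).injective ?_⟩
  rw [adj.homEquiv_unit, ← Functor.comp_map, ← adj.unit.naturality, Functor.id_map, Category.assoc,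
    IsIso.inv_hom_id, Category.comp_id]

lemma isIso_restrictFunctor_map {M N : X.Modules} (f : M ⟶ N)
    (h : ∀ Q, IsExtendedFrom Q (j ''ᵁ ⊤) → Function.Bijective fun g : N ⟶ Q ↦ f ≫ g) :
    IsIso ((Modules.restrictFunctor j).map f) := by
  let adj := Modules.restrictAdjunction j
  rw [isIso_iff_coyoneda_map_bijective]
  intro K
  have hK := h _ (isExtendedFrom_pushforward j K (j.preimage_image_eq ⊤))
  have hadj : (fun g ↦ (Modules.restrictFunctor j).map f ≫ g) =
      (adj.homEquiv M K).symm ∘ (fun g ↦ f ≫ g) ∘ adj.homEquiv N K := by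
    ext1 g
    exact ((adj.homEquiv M K).eq_symm_apply.2 (adj.homEquiv_naturality_left f g))
  rw [hadj]
  exact (adj.homEquiv M K).symm.bijective.comp (hK.comp (adj.homEquiv N K).bijective)

end OpenImmersion

lemma exists_moduleSpecΓFunctor_map_eq {R : CommRingCat.{u}} {M N : (Spec R).Modules}
    [M.IsQuasicoherent] (φ : moduleSpecΓFunctor.obj M ⟶ moduleSpecΓFunctor.obj N) :
    ∃ g : M ⟶ N, moduleSpecΓFunctor.map g = φ := by
  have : IsIso (tilde.adjunction.counit.app M) :=
    inferInstanceAs (IsIso M.fromTildeΓ)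
  refine ⟨inv (tilde.adjunction.counit.app M) ≫ (tilde.adjunction.homEquiv _ _).symm φ, ?_⟩
  rw [Functor.map_comp, Functor.map_inv, IsIso.inv_comp_eq,
    ← cancel_epi (tilde.adjunction.unit.app (moduleSpecΓFunctor.obj M)),
    tilde.adjunction.right_triangle_components_assoc]
  exact (tilde.adjunction.homEquiv_unit _ _ _).symm.trans (Equiv.apply_symm_apply _ _)

lemma exists_app_top_eq {R : CommRingCat.{u}} {M N : (Spec R).Modules} [M.IsQuasicoherent]
    (φ : Γ(M, ⊤) →ₗ[R] Γ(N, ⊤)) : ∃ g : M ⟶ N, ∀ s, g.app ⊤ s = φ s := by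
  let φ' : moduleSpecΓFunctor.obj M ⟶ moduleSpecΓFunctor.obj N := ConcreteCategory.ofHom φ
  obtain ⟨g, hg⟩ := exists_moduleSpecΓFunctor_map_eq φ'
  exact ⟨g, fun s ↦ congr($hg s)⟩

lemma exists_app_eq {M N : X.Modules} {U : X.Opens} (hU : IsAffineOpen U)
    (hM : IsLocalizingOver M U) (hN : IsExtendedFrom N U)
    (φ : Γ(M, U) →ₗ[Γ(X, U)] Γ(N, U)) : ∃ f : M ⟶ N, ∀ s, f.app U s = φ s := by
  obtain ⟨R, j, hj, rfl⟩ : ∃ (R : CommRingCat.{u}) (j : Spec R ⟶ X) (_ : IsOpenImmersion j),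
      j ''ᵁ ⊤ = U := ⟨_, hU.fromSpec, inferInstance, by simp⟩
  have := (isQuasicoherent_restrict_iff M j).2 hM
  obtain ⟨g, hg⟩ := exists_app_top_eq (M := M.restrict j) (N := N.restrict j)
    { toFun := φ, map_add' := φ.map_add, map_smul' := fun _ _ ↦ φ.map_smul _ _ }
  obtain ⟨f, rfl⟩ := exists_restrictFunctor_map_eq j hN g
  exact ⟨f, hg⟩

lemma exists_isExtendedFrom_bijective {U : X.Opens} (hU : IsAffineOpen U)
    (P : Type u) [AddCommGroup P] [Module Γ(X, U) P] :
    ∃ N : X.Modules, IsLocalizingOver N U ∧ IsExtendedFrom N U ∧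
      ∃ θ : P →ₗ[Γ(X, U)] Γ(N, U), Function.Bijective θ := by
  let K := tilde (ModuleCat.of Γ(X, U) P)
  have hK : IsLocalizingOver K ⊤ := (isQuasicoherent_iff_isLocalizingOver_top K).1 inferInstance
  refine ⟨(Modules.pushforward hU.fromSpec).obj K,
    IsLocalizingOver.pushforward _ (by rwa [hU.fromSpec_preimage_self]),
    isExtendedFrom_pushforward _ _ hU.fromSpec_preimage_self, ?_⟩
  let θ : P →ₗ[Γ(X, U)] Γ(K, hU.fromSpec ⁻¹ᵁ U) :=
    (tilde.toOpen (ModuleCat.of Γ(X, U) P) (hU.fromSpec ⁻¹ᵁ U)).hom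
  have hθ : Function.Bijective θ := by
    have h (W : (Spec Γ(X, U)).Opens) (hW : W = ⊤) :
        Function.Bijective (tilde.toOpen (ModuleCat.of Γ(X, U) P) W).hom := by
      subst hW
      exact ConcreteCategory.bijective_of_isIso (tilde.toOpen (ModuleCat.of Γ(X, U) P) ⊤)
    exact h _ hU.fromSpec_preimage_self
  refine ⟨{ toFun := θ, map_add' := θ.map_add, map_smul' := fun r s ↦ ?_ }, hθ⟩
  refine (θ.map_smul r s).trans ?_
  rw [Modules.smul_Spec_def]
  change _ = hU.fromSpec.app U r • θ s
  rw [hU.fromSpec_app_self]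
  rfl

end Extended

/-! ## Modules on the affine line -/

section AffineLine

open AlgebraicGeometry.Scheme TopologicalSpace

variable {X : Scheme.{u}}

lemma bijective_eval₂RingHom_C_X (R : Type u) [CommRing R] :
    Function.Bijective (Polynomial.eval₂RingHom (MvPolynomial.C (σ := PUnit.{u + 1}) (R := R))
      (MvPolynomial.X PUnit.unit)) := by
  let e := (MvPolynomial.uniqueAlgEquiv R PUnit.{u + 1}).symm
  have he : (e : Polynomial R →+* _) =
      Polynomial.eval₂RingHom MvPolynomial.C (MvPolynomial.X PUnit.unit) := by
    ext <;> simp [e]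
  exact he ▸ e.bijective

lemma bijective_appLE_of_isOpenImmersion {Y : Scheme.{u}} (j : Y ⟶ X) [IsOpenImmersion j]
    {V : X.Opens} (hV : j ''ᵁ ⊤ = V) (h : ⊤ ≤ j ⁻¹ᵁ V) : Function.Bijective (j.appLE V ⊤ h) := by
  subst hV
  rw [← ConcreteCategory.isIso_iff_bijective, ← Hom.appIso_hom']
  infer_instance

/-- The coordinate function on the part of the affine line that lies over `U`. -/
noncomputable abbrev coordinateOn (U : X.Opens) :
    Γ(X.affineLine, (X.affineLine ↘ X) ⁻¹ᵁ U) :=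
  restrictFunction le_top (affineLine.T X)

/-- The affine line over an affine open `U`, as a chart of the affine line over the whole scheme. -/
noncomputable def affineLineChart {U : X.Opens} (hU : IsAffineOpen U) :
    Spec (.of (MvPolynomial PUnit.{u + 1} Γ(X, U))) ⟶ X.affineLine :=
  (AffineSpace.SpecIso PUnit Γ(X, U)).inv ≫ AffineSpace.map PUnit hU.fromSpec

section Chart

variable {U : X.Opens} (hU : IsAffineOpen U)

instance (n : Type u) {S T : Scheme.{u}} (f : S ⟶ T) [IsOpenImmersion f] :
    IsOpenImmersion (AffineSpace.map n f) :=
  MorphismProperty.of_isPullback (AffineSpace.isPullback_map f).flip inferInstance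

instance : IsOpenImmersion (affineLineChart hU) :=
  inferInstanceAs (IsOpenImmersion (_ ≫ _))

lemma affineLineChart_over :
    affineLineChart hU ≫ (X.affineLine ↘ X) =
      Spec.map (CommRingCat.ofHom MvPolynomial.C) ≫ hU.fromSpec := by
  rw [affineLineChart, Category.assoc, AffineSpace.map_over, AffineSpace.SpecIso_inv_over_assoc]

lemma affineLineChart_appTop_T :
    (affineLineChart hU).appTop (affineLine.T X) =
      (ΓSpecIso _).inv (MvPolynomial.X PUnit.unit) := by
  rw [affineLineChart, Hom.comp_appTop, CommRingCat.comp_apply]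
  exact (congrArg _ (AffineSpace.map_appTop_coord _ _)).trans
    (AffineSpace.SpecIso_inv_appTop_coord _ _)

lemma affineLineChart_image_top :
    affineLineChart hU ''ᵁ ⊤ = (X.affineLine ↘ X) ⁻¹ᵁ U := by
  ext1
  have h := image_preimage_eq_of_isPullback
    (AffineSpace.isPullback_map (n := PUnit.{u + 1}) hU.fromSpec).flip .univ
  rw [Set.preimage_univ, Set.image_univ, Set.image_univ, hU.range_fromSpec] at h
  rw [Hom.image_top_eq_opensRange]
  exact (congrArg SetLike.coe (Hom.opensRange_comp_of_isIso _ _)).trans h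

lemma top_le_affineLineChart_preimage :
    ⊤ ≤ affineLineChart hU ⁻¹ᵁ (X.affineLine ↘ X) ⁻¹ᵁ U := by
  rw [← affineLineChart_image_top hU, Hom.preimage_image_eq]

/-- The functions on the part of the affine line that lies over the affine open `U`, as polynomials
over `Γ(X, U)`. -/
noncomputable def polynomialOfSection :
    Γ(X.affineLine, (X.affineLine ↘ X) ⁻¹ᵁ U) ⟶
      CommRingCat.of (MvPolynomial PUnit.{u + 1} Γ(X, U)) :=
  (affineLineChart hU).appLE _ ⊤ (top_le_affineLineChart_preimage hU) ≫ (ΓSpecIso _).hom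

lemma bijective_polynomialOfSection : Function.Bijective (polynomialOfSection hU) :=
  (ConcreteCategory.bijective_of_isIso (ΓSpecIso _).hom).comp
    (bijective_appLE_of_isOpenImmersion _ (affineLineChart_image_top hU) _)

lemma polynomialOfSection_coordinateOn :
    polynomialOfSection hU (coordinateOn U) = MvPolynomial.X PUnit.unit := by
  have hres : X.affineLine.presheaf.map (homOfLE le_top).op ≫
      (affineLineChart hU).appLE _ ⊤ (top_le_affineLineChart_preimage hU) =
        (affineLineChart hU).appTop :=
    (Hom.map_appLE _ _ _).trans (Hom.appLE_eq_app _)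
  refine (congrArg (ΓSpecIso _).hom
    (congr($hres (affineLine.T X)).trans (affineLineChart_appTop_T hU))).trans ?_
  exact congr($((ΓSpecIso _).inv_hom_id) _)

lemma app_comp_polynomialOfSection :
    (X.affineLine ↘ X).app U ≫ polynomialOfSection hU =
      CommRingCat.ofHom (MvPolynomial.C (σ := PUnit.{u + 1}) (R := Γ(X, U))) := by
  have happ (k : Spec (.of (MvPolynomial PUnit.{u + 1} Γ(X, U))) ⟶ X)
      (hk : affineLineChart hU ≫ (X.affineLine ↘ X) = k) (h : ⊤ ≤ k ⁻¹ᵁ U) :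
      (X.affineLine ↘ X).app U ≫
        (affineLineChart hU).appLE _ ⊤ (top_le_affineLineChart_preimage hU) = k.appLE U ⊤ h := by
    subst hk
    rw [Hom.app_eq_appLE, Hom.appLE_comp_appLE]
  have hle : ⊤ ≤ (Spec.map (CommRingCat.ofHom
      (MvPolynomial.C (σ := PUnit.{u + 1}) (R := Γ(X, U)))) ≫ hU.fromSpec) ⁻¹ᵁ U := by
    rw [Hom.comp_preimage, hU.fromSpec_preimage_self, Hom.preimage_top]
  rw [polynomialOfSection, ← Category.assoc, happ _ (affineLineChart_over hU) hle, Hom.comp_appLE,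
    hU.fromSpec_app_self, Category.assoc, Category.assoc, Iso.inv_comp_eq, ← ΓSpecIso_naturality]
  exact ((Category.assoc _ _ _).symm.trans
    (congrArg (· ≫ _) ((Hom.map_appLE _ _ _).trans (Hom.appLE_eq_app _))))

end Chart

/-- A polynomial with coefficients in `Γ(X, U)`, as a function on the part of the affine line that
lies over `U`. -/
noncomputable def sectionOfPolynomial (U : X.Opens) :
    Polynomial Γ(X, U) →+* Γ(X.affineLine, (X.affineLine ↘ X) ⁻¹ᵁ U) :=
  Polynomial.eval₂RingHom ((X.affineLine ↘ X).app U).hom (coordinateOn U)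

lemma bijective_sectionOfPolynomial {U : X.Opens} (hU : IsAffineOpen U) :
    Function.Bijective (sectionOfPolynomial U) := by
  have hcomp : (polynomialOfSection hU).hom.comp (sectionOfPolynomial U) =
      Polynomial.eval₂RingHom MvPolynomial.C (MvPolynomial.X PUnit.unit) := by
    refine Polynomial.ringHom_ext' (RingHom.ext fun r ↦ ?_) ?_
    · simp only [sectionOfPolynomial, RingHom.comp_apply, Polynomial.coe_eval₂RingHom,
        Polynomial.eval₂_C]
      exact congr($(app_comp_polynomialOfSection hU) r)
    · simp only [sectionOfPolynomial, RingHom.comp_apply, Polynomial.coe_eval₂RingHom,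
        Polynomial.eval₂_X]
      exact polynomialOfSection_coordinateOn hU
  refine (Function.Bijective.of_comp_iff' (bijective_polynomialOfSection hU) _).1 ?_
  change Function.Bijective ((polynomialOfSection hU).hom.comp (sectionOfPolynomial U))
  exact hcomp ▸ bijective_eval₂RingHom_C_X Γ(X, U)

end AffineLine

section Extension

open AlgebraicGeometry.Scheme

variable {X Y : Scheme.{u}} (π : Y ⟶ X) (r : Γ(Y, ⊤)) {M : X.Modules} (t : M ⟶ M)

/-- The universal `𝒪_Y`-module under `M` on which the endomorphism `t` of `M` becomes
multiplication by the function `r`. -/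
noncomputable abbrev universalExtension : Y.Modules :=
  cokernel ((Modules.pullback π).map t - Modules.mulBy _ r)

/-- The universal morphism from `M` to the direct image of a module on which `t` becomes
multiplication by `r`. -/
noncomputable def toUniversalExtension :
    M ⟶ (Modules.pushforward π).obj (universalExtension π r t) :=
  (Modules.pullbackPushforwardAdjunction π).homEquiv _ _ (cokernel.π _)

lemma comp_homEquiv_eq_iff {N : Y.Modules} (f : (Modules.pullback π).obj M ⟶ N) :
    t ≫ (Modules.pullbackPushforwardAdjunction π).homEquiv _ _ f =
        (Modules.pullbackPushforwardAdjunction π).homEquiv _ _ f ≫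
          (Modules.pushforward π).map (N.mulBy r) ↔
      ((Modules.pullback π).map t - Modules.mulBy _ r) ≫ f = 0 := by
  rw [← Adjunction.homEquiv_naturality_left, ← Adjunction.homEquiv_naturality_right,
    EmbeddingLike.apply_eq_iff_eq, ← Modules.mulBy_naturality, Preadditive.sub_comp, sub_eq_zero]

lemma comp_toUniversalExtension :
    t ≫ toUniversalExtension π r t =
      toUniversalExtension π r t ≫ (Modules.pushforward π).map (Modules.mulBy _ r) :=
  (comp_homEquiv_eq_iff π r t _).2 (cokernel.condition _)

variable {π r t}

lemma comp_toUniversalExtension_comp {N : Y.Modules} (f : universalExtension π r t ⟶ N) :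
    t ≫ toUniversalExtension π r t ≫ (Modules.pushforward π).map f =
      (toUniversalExtension π r t ≫ (Modules.pushforward π).map f) ≫
        (Modules.pushforward π).map (N.mulBy r) := by
  rw [← Category.assoc, comp_toUniversalExtension, Category.assoc, Category.assoc,
    ← Functor.map_comp, ← Functor.map_comp, Modules.mulBy_naturality]

lemma exists_toUniversalExtension_comp_eq {N : Y.Modules} {g : M ⟶ (Modules.pushforward π).obj N}
    (hg : t ≫ g = g ≫ (Modules.pushforward π).map (N.mulBy r)) :
    ∃ f : universalExtension π r t ⟶ N,
      toUniversalExtension π r t ≫ (Modules.pushforward π).map f = g := by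
  obtain ⟨f, rfl⟩ := ((Modules.pullbackPushforwardAdjunction π).homEquiv _ _).surjective g
  refine ⟨cokernel.desc _ f ((comp_homEquiv_eq_iff π r t f).1 hg), ?_⟩
  rw [toUniversalExtension, ← Adjunction.homEquiv_naturality_right, cokernel.π_desc]

lemma universalExtension_hom_ext {N : Y.Modules} {f g : universalExtension π r t ⟶ N}
    (h : toUniversalExtension π r t ≫ (Modules.pushforward π).map f =
      toUniversalExtension π r t ≫ (Modules.pushforward π).map g) : f = g := by
  rw [toUniversalExtension, ← Adjunction.homEquiv_naturality_right,
    ← Adjunction.homEquiv_naturality_right, EmbeddingLike.apply_eq_iff_eq] at h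
  exact coequalizer.hom_ext h

end Extension

section AffineLineModules

open AlgebraicGeometry.Scheme TopologicalSpace

variable {X : Scheme.{u}} {U : X.Opens}

lemma map_smul_of_map_smul_T (hU : IsAffineOpen U) {A B : Type*} [AddCommGroup A]
    [AddCommGroup B] [Module Γ(X.affineLine, (X.affineLine ↘ X) ⁻¹ᵁ U) A]
    [Module Γ(X.affineLine, (X.affineLine ↘ X) ⁻¹ᵁ U) B] (φ : A →+ B)
    (h : ∀ r s, φ ((X.affineLine ↘ X).app U r • s) = (X.affineLine ↘ X).app U r • φ s)
    (hT : ∀ s, φ (coordinateOn U • s) = coordinateOn U • φ s)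
    (a : Γ(X.affineLine, (X.affineLine ↘ X) ⁻¹ᵁ U)) (s : A) : φ (a • s) = a • φ s := by
  obtain ⟨p, rfl⟩ := (bijective_sectionOfPolynomial hU).2 a
  induction p using Polynomial.induction_on generalizing s with
  | C r => simpa [sectionOfPolynomial] using h r s
  | add p q hp hq => rw [map_add, add_smul, add_smul, φ.map_add, hp, hq]
  | monomial n r ih =>
    rw [pow_succ, ← mul_assoc, map_mul, mul_smul, mul_smul, ih]
    simp [sectionOfPolynomial, hT]

/-- An endomorphism `τ` of a module over `Γ(X, U)` makes the functions on the part of the affine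
line over the affine open `U` act, with the coordinate acting as `τ`. -/
noncomputable def sectionsToEnd (hU : IsAffineOpen U) {A : Type*} [AddCommGroup A]
    [Module Γ(X, U) A] (τ : Module.End Γ(X, U) A) :
    Γ(X.affineLine, (X.affineLine ↘ X) ⁻¹ᵁ U) →+* Module.End Γ(X, U) A :=
  (Polynomial.aeval τ).toRingHom.comp
    (RingEquiv.ofBijective _ (bijective_sectionOfPolynomial hU)).symm.toRingHom

section

variable (hU : IsAffineOpen U) {A : Type*} [AddCommGroup A] [Module Γ(X, U) A]
  (τ : Module.End Γ(X, U) A)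

lemma sectionsToEnd_sectionOfPolynomial (p : Polynomial Γ(X, U)) :
    sectionsToEnd hU τ (sectionOfPolynomial U p) = Polynomial.aeval τ p :=
  congrArg (Polynomial.aeval τ)
    ((RingEquiv.ofBijective _ (bijective_sectionOfPolynomial hU)).symm_apply_apply p)

lemma sectionsToEnd_app (r : Γ(X, U)) :
    sectionsToEnd hU τ ((X.affineLine ↘ X).app U r) = algebraMap _ _ r := by
  have h := sectionsToEnd_sectionOfPolynomial hU τ (Polynomial.C r)
  rwa [Polynomial.aeval_C, sectionOfPolynomial, Polynomial.coe_eval₂RingHom,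
    Polynomial.eval₂_C] at h

lemma sectionsToEnd_coordinateOn : sectionsToEnd hU τ (coordinateOn U) = τ := by
  have h := sectionsToEnd_sectionOfPolynomial hU τ Polynomial.X
  rwa [Polynomial.aeval_X, sectionOfPolynomial, Polynomial.coe_eval₂RingHom,
    Polynomial.eval₂_X] at h

end

lemma exists_isLocalizingOver_app_bijective (hU : IsAffineOpen U) {M : X.Modules}
    (hM : IsLocalizingOver M U) (t : M ⟶ M) :
    ∃ (N : X.affineLine.Modules) (f : M ⟶ (Modules.pushforward (X.affineLine ↘ X)).obj N),
      IsLocalizingOver N ((X.affineLine ↘ X) ⁻¹ᵁ U) ∧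
      t ≫ f = f ≫ (Modules.pushforward _).map (N.mulBy (affineLine.T X)) ∧
      Function.Bijective (f.app U) := by
  let τ : Module.End Γ(X, U) Γ(M, U) :=
    { toFun := t.app U, map_add' := map_add (t.app U).hom, map_smul' := t.app_smul }
  let := Module.compHom Γ(M, U) (sectionsToEnd hU τ)
  obtain ⟨N, hN, hN', θ, hθ⟩ :=
    exists_isExtendedFrom_bijective (hU.preimage (X.affineLine ↘ X)) Γ(M, U)
  let φ : Γ(M, U) →ₗ[Γ(X, U)] Γ((Modules.pushforward (X.affineLine ↘ X)).obj N, U) :=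
    { toFun := θ
      map_add' := θ.map_add
      map_smul' r s := (congrArg θ congr($(sectionsToEnd_app hU τ r) s).symm).trans
        (θ.map_smul ((X.affineLine ↘ X).app U r) s) }
  obtain ⟨f, hf⟩ := exists_app_eq hU hM hN'.pushforward φ
  refine ⟨N, f, hN, hom_ext_of_isExtendedFrom hU hM hN'.pushforward fun s ↦ ?_, ?_⟩
  · change f.app U (t.app U s) =
      coordinateOn U • (show Γ(N, _) from f.app U s)
    rw [hf, hf]
    exact (congrArg θ congr($(sectionsToEnd_coordinateOn hU τ) s).symm).trans
      (θ.map_smul (coordinateOn U) s)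
  · rwa [show (f.app U : Γ(M, U) → _) = θ from funext hf]

section

variable {M : X.Modules} {t : M ⟶ M} {N Q : X.affineLine.Modules}
  {f : M ⟶ (Modules.pushforward (X.affineLine ↘ X)).obj N}

lemma hom_ext_of_app_surjective (hU : IsAffineOpen U)
    (hN : IsLocalizingOver N ((X.affineLine ↘ X) ⁻¹ᵁ U)) (hf : Function.Surjective (f.app U))
    (hQ : IsExtendedFrom Q ((X.affineLine ↘ X) ⁻¹ᵁ U)) {h h' : N ⟶ Q}
    (hh : f ≫ (Modules.pushforward _).map h = f ≫ (Modules.pushforward _).map h') : h = h' := by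
  refine hom_ext_of_isExtendedFrom (hU.preimage _) hN hQ fun s ↦ ?_
  obtain ⟨s, rfl⟩ := hf s
  exact congr(Modules.Hom.app $hh U s)

lemma exists_comp_eq_of_app_bijective (hU : IsAffineOpen U) (hM : IsLocalizingOver M U)
    (hN : IsLocalizingOver N ((X.affineLine ↘ X) ⁻¹ᵁ U)) (hf : Function.Bijective (f.app U))
    (hfT : t ≫ f = f ≫ (Modules.pushforward _).map (N.mulBy (affineLine.T X)))
    (hQ : IsExtendedFrom Q ((X.affineLine ↘ X) ⁻¹ᵁ U))
    {g : M ⟶ (Modules.pushforward (X.affineLine ↘ X)).obj Q}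
    (hgT : t ≫ g = g ≫ (Modules.pushforward _).map (Q.mulBy (affineLine.T X))) :
    ∃ h : N ⟶ Q, f ≫ (Modules.pushforward _).map h = g := by
  let φ : Γ(N, (X.affineLine ↘ X) ⁻¹ᵁ U) →+ Γ(Q, (X.affineLine ↘ X) ⁻¹ᵁ U) :=
    (g.app U).hom.comp (AddEquiv.ofBijective (f.app U).hom hf).symm.toAddMonoidHom
  have hφ (s : Γ(M, U)) : φ (f.app U s) = g.app U s :=
    congrArg (g.app U) ((AddEquiv.ofBijective (f.app U).hom hf).symm_apply_apply s)
  have hφ_smul (r : Γ(X, U)) (s : Γ(N, (X.affineLine ↘ X) ⁻¹ᵁ U)) :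
      φ ((X.affineLine ↘ X).app U r • s) = (X.affineLine ↘ X).app U r • φ s := by
    obtain ⟨s, rfl⟩ := hf.2 s
    rw [hφ]
    exact ((congrArg φ (f.app_smul r s).symm).trans (hφ _)).trans (g.app_smul r s)
  have hφ_T (s : Γ(N, (X.affineLine ↘ X) ⁻¹ᵁ U)) :
      φ (coordinateOn U • s) = coordinateOn U • φ s := by
    obtain ⟨s, rfl⟩ := hf.2 s
    rw [hφ]
    exact ((congrArg φ congr(Modules.Hom.app $hfT U s).symm).trans (hφ _)).trans
      congr(Modules.Hom.app $hgT U s)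
  obtain ⟨h, hh⟩ := exists_app_eq (hU.preimage (X.affineLine ↘ X)) hN hQ
    { toFun := φ, map_add' := φ.map_add, map_smul' := map_smul_of_map_smul_T hU φ hφ_smul hφ_T }
  exact ⟨h, hom_ext_of_isExtendedFrom hU hM hQ.pushforward fun s ↦ (hh _).trans (hφ s)⟩

end

end AffineLineModules

lemma isEquivalence_of_exists_objIso {C : Type*} [Category* C] {D : Type*} [Category* D]
    (F : C ⥤ D) [F.Faithful] [F.ReflectsIsomorphisms]
    (h : ∀ Y, ∃ (P : C) (i : Y ≅ F.obj P), ∀ N (g : Y ⟶ F.obj N), ∃ f, i.hom ≫ F.map f = g) :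
    F.IsEquivalence where
  essSurj := ⟨fun Y ↦ have ⟨P, i, _⟩ := h Y; ⟨P, ⟨i.symm⟩⟩⟩
  full := ⟨fun {M N} g ↦ by
    obtain ⟨P, i, hi⟩ := h (F.obj M)
    obtain ⟨ε, hε⟩ := hi M (𝟙 _)
    obtain ⟨f, rfl⟩ := hi N g
    have : IsIso (F.map ε) := IsIso.of_isIso_fac_left hε
    have : IsIso ε := isIso_of_reflects_iso ε F
    refine ⟨inv ε ≫ f, ?_⟩
    rw [F.map_comp, F.map_inv, IsIso.inv_eq_of_inv_hom_id hε]⟩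

section AffineLineEquivalence

open AlgebraicGeometry.Scheme

variable {X : Scheme.{u}}

lemma bijective_app_of_isIso_restrictFunctor_map {Y : Scheme.{u}} (j : Y ⟶ X) [IsOpenImmersion j]
    {M N : X.Modules} (f : M ⟶ N) [IsIso ((Modules.restrictFunctor j).map f)] :
    Function.Bijective (f.app (j ''ᵁ ⊤)) :=
  ConcreteCategory.bijective_of_isIso (((Modules.restrictFunctor j).map f).app ⊤)

lemma isLocalizingOver_of_isIso_restrictFunctor_map {U : X.Opens} (hU : IsAffineOpen U)
    {M N : X.Modules} (f : M ⟶ N) [IsIso ((Modules.restrictFunctor hU.fromSpec).map f)]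
    (hN : IsLocalizingOver N U) : IsLocalizingOver M U :=
  (isLocalizingOver_iff M hU).2 <|
    (isQcoh _).prop_of_iso (asIso ((Modules.restrictFunctor hU.fromSpec).map f)).symm
      ((isLocalizingOver_iff N hU).1 hN)

variable {M : X.Modules} {t : M ⟶ M}

/-- The universal module on the affine line under `M` on which the endomorphism `t` of `M` becomes
multiplication by the coordinate. -/
noncomputable abbrev coordinateExtension (t : M ⟶ M) : X.affineLine.Modules :=
  universalExtension (X.affineLine ↘ X) (affineLine.T X) t

lemma exists_isIso_restrictFunctor_map {U : X.Opens} (hU : IsAffineOpen U)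
    (hM : IsLocalizingOver M U) :
    ∃ (N : X.affineLine.Modules) (a : coordinateExtension t ⟶ N),
      IsLocalizingOver N ((X.affineLine ↘ X) ⁻¹ᵁ U) ∧
      IsIso ((Modules.restrictFunctor (hU.preimage (X.affineLine ↘ X)).fromSpec).map a) ∧
      Function.Bijective
        ((toUniversalExtension _ _ t ≫ (Modules.pushforward (X.affineLine ↘ X)).map a).app U) := by
  obtain ⟨N, f, hN, hfT, hf⟩ := exists_isLocalizingOver_app_bijective hU hM t
  obtain ⟨a, rfl⟩ := exists_toUniversalExtension_comp_eq hfT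
  refine ⟨N, a, hN, isIso_restrictFunctor_map _ a fun Q hQ ↦ ⟨fun h h' hh ↦ ?_, fun k ↦ ?_⟩, hf⟩
  all_goals rw [Hom.image_top_eq_opensRange, IsAffineOpen.opensRange_fromSpec] at hQ
  · refine hom_ext_of_app_surjective hU hN hf.2 hQ ?_
    rw [Category.assoc, Category.assoc, ← Functor.map_comp, ← Functor.map_comp,
      show a ≫ h = a ≫ h' from hh]
  · obtain ⟨h, hh⟩ := exists_comp_eq_of_app_bijective hU hM hN hf hfT hQ
      (g := toUniversalExtension _ _ t ≫ (Modules.pushforward _).map k)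
      (comp_toUniversalExtension_comp k)
    refine ⟨h, universalExtension_hom_ext ?_⟩
    rwa [Category.assoc, ← Functor.map_comp] at hh

lemma isLocalizingOver_coordinateExtension {U : X.Opens} (hU : IsAffineOpen U)
    (hM : IsLocalizingOver M U) :
    IsLocalizingOver (coordinateExtension t) ((X.affineLine ↘ X) ⁻¹ᵁ U) := by
  obtain ⟨N, a, hN, _, _⟩ := exists_isIso_restrictFunctor_map (t := t) hU hM
  exact isLocalizingOver_of_isIso_restrictFunctor_map (hU.preimage _) a hN

lemma bijective_toUniversalExtension_app {U : X.Opens} (hU : IsAffineOpen U)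
    (hM : IsLocalizingOver M U) :
    Function.Bijective ((toUniversalExtension (X.affineLine ↘ X) (affineLine.T X) t).app U) := by
  obtain ⟨N, a, _, _, h⟩ := exists_isIso_restrictFunctor_map (t := t) hU hM
  have ha := bijective_app_of_isIso_restrictFunctor_map (hU.preimage (X.affineLine ↘ X)).fromSpec a
  rw [Hom.image_top_eq_opensRange, IsAffineOpen.opensRange_fromSpec] at ha
  exact (Function.Bijective.of_comp_iff' ha _).1 h

variable [M.IsQuasicoherent]

instance : (coordinateExtension t).IsQuasicoherent :=
  isQuasicoherent_of_locally_isLocalizingOver fun x ↦ by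
    obtain ⟨U, hU, hx, _⟩ :=
      exists_isAffineOpen_mem_and_subset (x := (X.affineLine ↘ X) x) (U := ⊤) trivial
    exact ⟨_, hU.preimage (X.affineLine ↘ X), hx,
      isLocalizingOver_coordinateExtension hU (isLocalizingOver_of_isQuasicoherent M hU)⟩

instance : IsIso (toUniversalExtension (X.affineLine ↘ X) (affineLine.T X) t) :=
  isIso_of_bijective_app_affine fun _ hU ↦
    bijective_toUniversalExtension_app hU (isLocalizingOver_of_isQuasicoherent M hU)

end AffineLineEquivalence

section PushforwardLoop

open AlgebraicGeometry.Scheme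

/-- A natural transformation between diagrams of shape `Loop`, from a morphism that commutes with
the generating endomorphisms. -/
def Loop.natTransMk {C : Type*} [Category* C] {F G : Loop.{u} ⥤ C}
    (f : F.obj PUnit.unit ⟶ G.obj PUnit.unit)
    (h : F.map (X := PUnit.unit) (Y := PUnit.unit) ⟨1⟩ ≫ f =
      f ≫ G.map (X := PUnit.unit) (Y := PUnit.unit) ⟨1⟩) : F ⟶ G where
  app _ := f
  naturality := by
    have map_succ (F : Loop.{u} ⥤ C) (n : ℕ) :
        F.map (X := PUnit.unit) (Y := PUnit.unit) ⟨n + 1⟩ = F.map ⟨n⟩ ≫ F.map ⟨1⟩ :=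
      F.map_comp (X := (PUnit.unit : Loop)) (Y := PUnit.unit) (Z := PUnit.unit) ⟨n⟩ ⟨1⟩
    have map_zero (F : Loop.{u} ⥤ C) :
        F.map (X := PUnit.unit) (Y := PUnit.unit) ⟨0⟩ = 𝟙 _ :=
      F.map_id (PUnit.unit : Loop)
    rintro ⟨⟩ ⟨⟩ ⟨n⟩
    induction n with
    | zero => rw [map_zero F, map_zero G, Category.id_comp, Category.comp_id]
    | succ n ih =>
      rw [map_succ F, map_succ G, Category.assoc, h, ← Category.assoc, ih, Category.assoc]

variable {X : Scheme.{u}}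

variable (X) in
/-- The restriction of `pushforwardLoop` to quasi-coherent modules. -/
noncomputable def qcohPushforwardLoop : X.affineLine.Qcoh ⥤ (Loop.{u} ⥤ X.Qcoh) where
  obj M := X.isQcoh.lift (X.pushforwardLoop.obj M.obj) fun _ ↦
    have : M.obj.IsQuasicoherent := M.property
    isQuasicoherent_pushforward _ _
  map f :=
    { app l := ObjectProperty.homMk ((X.pushforwardLoop.map f.hom).app l)
      naturality _ _ n := by
        ext : 1
        exact (X.pushforwardLoop.map f.hom).naturality n }

lemma qcohPushforwardLoop_obj_map_one (N : X.affineLine.Qcoh) :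
    (((qcohPushforwardLoop X).obj N).map (X := PUnit.unit) (Y := PUnit.unit) ⟨1⟩).hom =
      (Modules.pushforward _).map (N.obj.mulBy (affineLine.T X)) :=
  congrArg (fun r ↦ (Modules.pushforward _).map (N.obj.mulBy r)) (pow_one _)

instance : (qcohPushforwardLoop X).Faithful where
  map_injective {M N f g} h := by
    have : M.obj.IsQuasicoherent := M.property
    have hfg : (Modules.pushforward (X.affineLine ↘ X)).map f.hom =
        (Modules.pushforward (X.affineLine ↘ X)).map g.hom :=
      congr(($h).app PUnit.unit |>.hom)
    ext W s
    refine app_eq_of_locally (fun x hx ↦ ?_) s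
    obtain ⟨U, hU, hxU, _⟩ :=
      exists_isAffineOpen_mem_and_subset (x := (X.affineLine ↘ X) x) (U := ⊤) trivial
    have hV : IsAffineOpen ((X.affineLine ↘ X) ⁻¹ᵁ U) := hU.preimage _
    exact ⟨W ⊓ _, inf_le_left, ⟨hx, hxU⟩, app_eq_of_isLocalizingOver hV
      (isLocalizingOver_of_isQuasicoherent M.obj hV)
      (fun s ↦ congr(Modules.Hom.app $hfg U s)) inf_le_right⟩

lemma exists_comp_qcohPushforwardLoop_map_eq (Y : Loop.{u} ⥤ X.Qcoh) :
    ∃ (P : X.affineLine.Qcoh) (i : Y ≅ (qcohPushforwardLoop X).obj P),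
      ∀ N (g : Y ⟶ (qcohPushforwardLoop X).obj N),
        ∃ f, i.hom ≫ (qcohPushforwardLoop X).map f = g := by
  let M := (Y.obj PUnit.unit).obj
  have : M.IsQuasicoherent := (Y.obj PUnit.unit).property
  let t : M ⟶ M := (Y.map (X := PUnit.unit) (Y := PUnit.unit) ⟨1⟩).hom
  let P : X.affineLine.Qcoh := ⟨coordinateExtension t, inferInstance⟩
  let η := toUniversalExtension (X.affineLine ↘ X) (affineLine.T X) t
  let η' : Y.obj PUnit.unit ⟶ ((qcohPushforwardLoop X).obj P).obj PUnit.unit :=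
    ObjectProperty.homMk η
  have : IsIso (X.isQcoh.ι.map η') := inferInstanceAs (IsIso η)
  have : IsIso η' := isIso_of_reflects_iso _ X.isQcoh.ι
  let i : Y ⟶ (qcohPushforwardLoop X).obj P := Loop.natTransMk η' (by
    ext : 1
    exact (comp_toUniversalExtension _ _ t).trans
      (congrArg (η ≫ ·) (qcohPushforwardLoop_obj_map_one P).symm))
  have : IsIso i := (NatTrans.isIso_iff_isIso_app i).2 fun _ ↦ ‹IsIso η'›
  refine ⟨P, asIso i, fun N g ↦ ?_⟩
  have hg : t ≫ (g.app PUnit.unit).hom = (g.app PUnit.unit).hom ≫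
      (Modules.pushforward _).map (N.obj.mulBy (affineLine.T X)) :=
    congr($(g.naturality (X := PUnit.unit) (Y := PUnit.unit) ⟨1⟩).hom).trans
      (congrArg ((g.app PUnit.unit).hom ≫ ·) (qcohPushforwardLoop_obj_map_one N))
  obtain ⟨f, hf⟩ := exists_toUniversalExtension_comp_eq hg
  refine ⟨ObjectProperty.homMk f, ?_⟩
  ext l : 3
  exact hf

instance : (qcohPushforwardLoop X).IsEquivalence :=
  isEquivalence_of_exists_objIso _ exists_comp_qcohPushforwardLoop_map_eq

end PushforwardLoop

/-! ## Strong equivalences of prederivators -/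

section TwoNatural

open Bicategory
open scoped Pseudofunctor.StrongTrans

universe w₁ w₂ v₁ v₂ u₁ u₂

variable {B : Type u₁} [Bicategory.{w₁, v₁} B] {C : Type u₂} [Bicategory.{w₂, v₂} C]

/-- A strong transformation between pseudofunctors of strict bicategories is *2-natural* if its
naturality squares commute strictly. -/
structure IsTwoNatural {F G : Pseudofunctor B C} (η : F ⟶ G) : Prop where
  naturality_eq {a b : B} (f : a ⟶ b) : ∃ h, η.naturality f = eqToIso h

namespace IsTwoNatural

variable {F G H : Pseudofunctor B C} {η θ : F ⟶ G}

lemma comm (hη : IsTwoNatural η) {a b : B} (f : a ⟶ b) :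
    F.map f ≫ η.app b = η.app a ≫ G.map f :=
  (hη.naturality_eq f).choose

lemma naturality_hom (hη : IsTwoNatural η) {a b : B} (f : a ⟶ b) :
    (η.naturality f).hom = eqToHom (hη.comm f) :=
  congrArg Iso.hom (hη.naturality_eq f).choose_spec

/-- An invertible modification between 2-natural transformations. -/
def isoMk (hη : IsTwoNatural η) (hθ : IsTwoNatural θ) (app : ∀ a, η.app a ≅ θ.app a)
    (naturality : ∀ {a b : B} (f : a ⟶ b), F.map f ◁ (app b).hom =
      eqToHom (hη.comm f) ≫ (app a).hom ▷ G.map f ≫ eqToHom (hθ.comm f).symm) :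
    η ≅ θ :=
  Pseudofunctor.StrongTrans.isoMk app fun f ↦ by
    rw [naturality, hη.naturality_hom, hθ.naturality_hom]
    simp

/-- 2-natural transformations with equal components are isomorphic. -/
def isoOfAppEq (hη : IsTwoNatural η) (hθ : IsTwoNatural θ) (h : ∀ a, η.app a = θ.app a) : η ≅ θ :=
  hη.isoMk hθ (fun a ↦ eqToIso (h a)) fun f ↦ by simp

variable [Bicategory.Strict C]

protected lemma id (F : Pseudofunctor B C) : IsTwoNatural (𝟙 F) where
  naturality_eq f := by
    refine ⟨(Strict.comp_id (F.map f)).trans (Strict.id_comp _).symm, Iso.ext ?_⟩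
    change (ρ_ (F.map f)).hom ≫ (λ_ (F.map f)).inv = _
    rw [Strict.rightUnitor_eqToIso, Strict.leftUnitor_eqToIso]
    exact eqToHom_trans (Strict.comp_id _) (Strict.id_comp (F.map f)).symm

lemma comp {θ : G ⟶ H} (hη : IsTwoNatural η) (hθ : IsTwoNatural θ) :
    IsTwoNatural (η ≫ θ) where
  naturality_eq {a b} f := by
    have h : F.map f ≫ η.app b ≫ θ.app b = (η.app a ≫ θ.app a) ≫ H.map f := by
      rw [← Strict.assoc, hη.comm, Strict.assoc, hθ.comm, Strict.assoc]
    refine ⟨h, Iso.ext ?_⟩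
    change (α_ _ _ _).inv ≫ (η.naturality f).hom ▷ θ.app b ≫ (α_ _ _ _).hom ≫
      η.app a ◁ (θ.naturality f).hom ≫ (α_ _ _ _).inv = eqToHom h
    simp [hη.naturality_hom, hθ.naturality_hom, Strict.associator_eqToIso]

end IsTwoNatural

variable [Bicategory.Strict B] [Bicategory.Strict C] {F G : StrictPseudofunctor B C}

/-- The strong transformation between strict pseudofunctors with the given components, whose
naturality constraints are equalities. -/
def twoNaturalTrans (app : ∀ a, F.obj a ⟶ G.obj a)
    (comm : ∀ {a b : B} (f : a ⟶ b), F.map f ≫ app b = app a ≫ G.map f)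
    (comm₂ : ∀ {a b : B} {f g : a ⟶ b} (α : f ⟶ g),
      F.map₂ α ▷ app b = eqToHom (comm f) ≫ app a ◁ G.map₂ α ≫ eqToHom (comm g).symm) :
    F.toPseudofunctor ⟶ G.toPseudofunctor where
  app := app
  naturality f := eqToIso (comm f)
  naturality_naturality α := by
    rw [comm₂]; simp
  naturality_id a := by
    rw [F.mapId_eq_eqToIso, G.mapId_eq_eqToIso, Strict.leftUnitor_eqToIso,
      Strict.rightUnitor_eqToIso]
    simp
  naturality_comp f g := by
    rw [F.mapComp_eq_eqToIso, G.mapComp_eq_eqToIso]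
    simp [Strict.associator_eqToIso]

lemma isTwoNatural_twoNaturalTrans (app : ∀ a, F.obj a ⟶ G.obj a)
    (comm : ∀ {a b : B} (f : a ⟶ b), F.map f ≫ app b = app a ≫ G.map f)
    (comm₂ : ∀ {a b : B} {f g : a ⟶ b} (α : f ⟶ g),
      F.map₂ α ▷ app b = eqToHom (comm f) ≫ app a ◁ G.map₂ α ≫ eqToHom (comm g).symm) :
    IsTwoNatural (twoNaturalTrans app comm comm₂) :=
  ⟨fun _ ↦ ⟨_, rfl⟩⟩

lemma whiskerRight_inv_eq_conj {a b a' b' : C} (u : a ≅ a') (v : b ≅ b')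
    {f g : a ⟶ b} {f' g' : a' ⟶ b'} (hf : f ≫ v.hom = u.hom ≫ f') (hg : g ≫ v.hom = u.hom ≫ g')
    (hf' : f' ≫ v.inv = u.inv ≫ f) (hg' : g' ≫ v.inv = u.inv ≫ g) {α : f ⟶ g} {β : f' ⟶ g'}
    (h : α ▷ v.hom = eqToHom hf ≫ u.hom ◁ β ≫ eqToHom hg.symm) :
    β ▷ v.inv = eqToHom hf' ≫ u.inv ◁ α ≫ eqToHom hg'.symm := by
  have hv : v.hom ≫ v.inv = 𝟙 b := v.hom_inv_id
  have hu : u.inv ≫ u.hom = 𝟙 a' := u.inv_hom_id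
  have hα : α = eqToHom (by simp) ≫ α ▷ v.hom ▷ v.inv ≫ eqToHom (by simp) := calc
    α = (ρ_ f).inv ≫ α ▷ 𝟙 b ≫ (ρ_ g).hom := by simp
    _ = _ := by
      rw [whiskerRight_congr hv.symm]
      simp [Strict.associator_eqToIso, Strict.rightUnitor_eqToIso]
  have hβ : β ▷ v.inv = eqToHom (by simp) ≫ u.inv ◁ u.hom ◁ β ▷ v.inv ≫ eqToHom (by simp) := calc
    β ▷ v.inv = (λ_ _).inv ≫ 𝟙 a' ◁ β ▷ v.inv ≫ (λ_ _).hom := by simp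
    _ = _ := by
      rw [congr_whiskerLeft hu.symm]
      simp [Strict.associator_eqToIso, Strict.leftUnitor_eqToIso]
  rw [hβ, hα]
  simp [h, Strict.associator_eqToIso]

/-- 2-natural isomorphisms `F.obj a ≅ G.obj a`, as an equivalence of pseudofunctors. -/
def twoNaturalEquivalence (app : ∀ a, F.obj a ≅ G.obj a)
    (comm : ∀ {a b : B} (f : a ⟶ b), F.map f ≫ (app b).hom = (app a).hom ≫ G.map f)
    (comm₂ : ∀ {a b : B} {f g : a ⟶ b} (α : f ⟶ g), F.map₂ α ▷ (app b).hom =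
      eqToHom (comm f) ≫ (app a).hom ◁ G.map₂ α ≫ eqToHom (comm g).symm) :
    Bicategory.Equivalence F.toPseudofunctor G.toPseudofunctor :=
  let hom := twoNaturalTrans (fun a ↦ (app a).hom) comm comm₂
  have comm_inv {a b : B} (f : a ⟶ b) : G.map f ≫ (app b).inv = (app a).inv ≫ F.map f := by
    rw [Iso.comp_inv_eq, Category.assoc, comm, Iso.inv_hom_id_assoc]
  let inv := twoNaturalTrans (fun a ↦ (app a).inv) comm_inv fun {_ _ f g} α ↦
    whiskerRight_inv_eq_conj _ _ (comm f) (comm g) (comm_inv f) (comm_inv g) (comm₂ α)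
  have hhom : IsTwoNatural hom := isTwoNatural_twoNaturalTrans ..
  have hinv : IsTwoNatural inv := isTwoNatural_twoNaturalTrans ..
  .mkOfAdjointifyCounit
    ((IsTwoNatural.id _).isoOfAppEq (hhom.comp hinv) fun a ↦ (app a).hom_inv_id.symm)
    ((hinv.comp hhom).isoOfAppEq (.id _) fun a ↦ (app a).inv_hom_id)

end TwoNatural

namespace Prederivator

noncomputable section

open Bicategory
open scoped Pseudofunctor.StrongTrans

/-- The composite of two strong equivalences of prederivators. -/
def StrongEquivalence.trans {D E F : Prederivator.{u}} (Φ : StrongEquivalence D E)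
    (Ψ : StrongEquivalence E F) : StrongEquivalence D F where
  equiv := .mkOfAdjointifyCounit (f := Φ.equiv.hom ≫ Ψ.equiv.hom) (g := Ψ.equiv.inv ≫ Φ.equiv.inv)
    (Φ.equiv.unit ≪≫ whiskerLeftIso _ ((λ_ _).symm ≪≫
      whiskerRightIso Ψ.equiv.unit _ ≪≫ α_ _ _ _) ≪≫ (α_ _ _ _).symm)
    (α_ _ _ _ ≪≫ whiskerLeftIso _ ((α_ _ _ _).symm ≪≫ whiskerRightIso Φ.equiv.counit _ ≪≫
      λ_ _) ≪≫ Ψ.equiv.counit)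
  hom_strict := (IsTwoNatural.comp ⟨Φ.hom_strict⟩ ⟨Ψ.hom_strict⟩).naturality_eq
  inv_strict := (IsTwoNatural.comp ⟨Ψ.inv_strict⟩ ⟨Φ.inv_strict⟩).naturality_eq

namespace Derived

variable {A : Type w} [Category.{v} A] [Abelian A] {B : Type w} [Category.{v} B] [Abelian B]
  {C : Type w} [Category.{v} C] [Abelian C]

lemma functor_ext {D : Type*} [Category* D] {F G : Derived A ⥤ D} (h : Q A ⋙ F = Q A ⋙ G) :
    F = G :=
  Localization.Construction.uniq _ _ h

lemma map_congr {F G : A ⥤ B} [F.Additive] [F.PreservesHomology] [G.Additive]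
    [G.PreservesHomology] (h : F = G) : map F = map G := by
  subst h; rfl

variable (A) in
protected lemma map_id : map (𝟭 A) = 𝟭 (Derived A) :=
  functor_ext (Q_map _)

section comp

variable (F : A ⥤ B) [F.Additive] [F.PreservesHomology] (G : B ⥤ C) [G.Additive]
  [G.PreservesHomology]

scoped instance preservesHomology_comp : (F ⋙ G).PreservesHomology :=
  (F ⋙ G).preservesHomology_of_map_exact fun _ hS ↦ (hS.map F).map G

protected lemma map_comp : map (F ⋙ G) = map F ⋙ map G :=
  functor_ext <| by
    rw [Q_map, ← Functor.assoc, Q_map, Functor.assoc, Q_map]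
    rfl

end comp

section map₂

variable {F G H : A ⥤ B} [F.Additive] [F.PreservesHomology] [G.Additive] [G.PreservesHomology]
  [H.Additive] [H.PreservesHomology]

variable (F) in
lemma map₂_id : map₂ (𝟙 F) = 𝟙 (map F) :=
  map₂_ext fun K ↦ by
    rw [map₂_app, NatTrans.mapHomologicalComplex_id]
    exact (Q B).map_id _

lemma map₂_comp (α : F ⟶ G) (β : G ⟶ H) : map₂ (α ≫ β) = map₂ α ≫ map₂ β :=
  map₂_ext fun K ↦ by
    refine (map₂_app _ K).trans (Eq.trans ?_ (congrArg₂ (· ≫ ·) (map₂_app α K) (map₂_app β K)).symm)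
    rw [NatTrans.mapHomologicalComplex_comp]
    exact (Q B).map_comp _ _

/-- The isomorphism of derived functors induced by an isomorphism of exact functors. -/
@[simps]
def mapIso (α : F ≅ G) : map F ≅ map G where
  hom := map₂ α.hom
  inv := map₂ α.inv
  hom_inv_id := by rw [← map₂_comp, α.hom_inv_id, map₂_id]
  inv_hom_id := by rw [← map₂_comp, α.inv_hom_id, map₂_id]

end map₂

section unit

variable (F : A ⥤ B) [F.Additive] [F.PreservesHomology] (G : B ⥤ A) [G.Additive]
  [G.PreservesHomology] (α : 𝟭 A ≅ F ⋙ G)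

/-- The isomorphism `𝟭 ≅ D(F) ⋙ D(G)` induced by `𝟭 ≅ F ⋙ G`. -/
def unitIso : 𝟭 (Derived A) ≅ map F ⋙ map G :=
  eqToIso (Derived.map_id A).symm ≪≫ mapIso α ≪≫ eqToIso (Derived.map_comp F G)

lemma unitIso_hom_app (K : CochainComplex A ℤ) : (unitIso F G α).hom.app ((Q A).obj K) =
    (Q A).map ((NatTrans.mapHomologicalComplex α.hom (ComplexShape.up ℤ)).app K) := by
  simp only [unitIso, Iso.trans_hom, eqToIso.hom, mapIso_hom, NatTrans.comp_app, eqToHom_app,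
    map₂_app]
  exact (Category.id_comp _).trans (Category.comp_id _)

end unit

end Derived

section whiskeringRight

variable {A : Type (u + 1)} [Category.{u} A] [Abelian A] {B : Type (u + 1)} [Category.{u} B]
  [Abelian B] (G : A ⥤ B) [G.Additive] (I : Type u) [Category.{u} I]

scoped instance additive_whiskeringRight : ((Functor.whiskeringRight I A B).obj G).Additive where
  map_add := by
    intros
    ext
    exact G.map_add

scoped instance preservesHomology_whiskeringRight [G.PreservesHomology] :
    ((Functor.whiskeringRight I A B).obj G).PreservesHomology :=
  have := G.preservesFiniteLimits_of_preservesHomology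
  have := G.preservesFiniteColimits_of_preservesHomology
  have : PreservesFiniteLimits ((Functor.whiskeringRight I A B).obj G) :=
    ⟨fun _ _ _ ↦ inferInstance⟩
  have : PreservesFiniteColimits ((Functor.whiskeringRight I A B).obj G) :=
    ⟨fun _ _ _ ↦ inferInstance⟩
  inferInstance

/-- The 2-natural transformation of prederivators induced by an exact functor, with components
`D(A^I) ⥤ D(B^I)`. -/
def ofAbelianMap [G.PreservesHomology] :
    (ofAbelian A).toPseudofunctor ⟶ (ofAbelian B).toPseudofunctor :=
  twoNaturalTrans (fun I ↦ (Derived.map ((Functor.whiskeringRight I.unop A B).obj G)).toCatHom)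
    (fun {I J} F ↦ Cat.Hom.ext <|
      (Derived.map_comp ((Functor.whiskeringLeft _ _ A).obj F.unop.toFunctor)
        ((Functor.whiskeringRight J.unop A B).obj G)).symm.trans <|
      Derived.map_comp ((Functor.whiskeringRight I.unop A B).obj G)
        ((Functor.whiskeringLeft _ _ B).obj F.unop.toFunctor))
    fun {I J F F'} α ↦ cat_hom₂_eq_conj _ _ _ _ fun X ↦ by
      obtain ⟨K, rfl⟩ := (Localization.Construction.objEquiv _).surjective X
      refine heq_of_eq <| (congrArg (Derived.map _).map (Derived.map₂_app
        ((Functor.whiskeringLeft _ _ A).map α.unop2.toNatTrans) K)).trans <|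
          (Derived.map_Q_map _ _).trans ?_
      exact (Derived.map₂_app ((Functor.whiskeringLeft _ _ B).map α.unop2.toNatTrans)
        ((((Functor.whiskeringRight I.unop A B).obj G).mapHomologicalComplex _).obj K)).symm

lemma isTwoNatural_ofAbelianMap [G.PreservesHomology] : IsTwoNatural (ofAbelianMap G) :=
  ⟨fun _ ↦ ⟨_, rfl⟩⟩

end whiskeringRight

scoped instance additive_of_isEquivalence {A B : Type*} [Category* A] [Abelian A] [Category* B]
    [Abelian B] (F : A ⥤ B) [F.IsEquivalence] : F.Additive :=
  F.additive_of_preserves_binary_products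

section ofAbelianEquivalence

variable {A : Type (u + 1)} [Category.{u} A] [Abelian A] {B : Type (u + 1)} [Category.{u} B]
  [Abelian B] (e : A ≌ B)

/-- The unit of `e`, as an invertible modification. -/
def ofAbelianUnitIso :
    𝟙 (ofAbelian A).toPseudofunctor ≅ ofAbelianMap e.functor ≫ ofAbelianMap e.inverse :=
  (IsTwoNatural.id _).isoMk
    ((isTwoNatural_ofAbelianMap e.functor).comp (isTwoNatural_ofAbelianMap e.inverse))
    (fun I ↦ Cat.Hom.isoMk (Derived.unitIso ((Functor.whiskeringRight I.unop A B).obj e.functor)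
      ((Functor.whiskeringRight I.unop B A).obj e.inverse)
      ((Functor.whiskeringRight I.unop A A).mapIso e.unitIso)))
    fun {I J} F ↦ cat_hom₂_eq_conj _ _ _ _ fun X ↦ by
      obtain ⟨K, rfl⟩ := (Localization.Construction.objEquiv _).surjective X
      refine heq_of_eq <| (Derived.unitIso_hom_app _ _ _ ((((Functor.whiskeringLeft _ _ A).obj
        F.unop.toFunctor).mapHomologicalComplex _).obj K)).trans (Eq.symm ?_)
      exact (congrArg (Derived.map ((Functor.whiskeringLeft _ _ A).obj F.unop.toFunctor)).map
        (Derived.unitIso_hom_app _ _ _ K)).trans (Derived.map_Q_map _ _)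

/-- An equivalence of abelian categories induces a strong equivalence of prederivators. -/
def ofAbelianEquivalence : StrongEquivalence (ofAbelian A) (ofAbelian B) where
  equiv := .mkOfAdjointifyCounit (ofAbelianUnitIso e) (ofAbelianUnitIso e.symm).symm
  hom_strict := (isTwoNatural_ofAbelianMap e.functor).naturality_eq
  inv_strict := (isTwoNatural_ofAbelianMap e.inverse).naturality_eq

end ofAbelianEquivalence

section flipCurrying

variable (I L : Type*) [Category* I] [Category* L] (B : Type*) [Category* B]

/-- The equivalence `(B^L)^I ≌ B^(L × I)`. -/
abbrev flipCurrying : (I ⥤ L ⥤ B) ≌ (L × I ⥤ B) :=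
  Functor.flipping.trans Functor.currying

lemma flipCurrying_functor_comp_inverse :
    (flipCurrying I L B).functor ⋙ (flipCurrying I L B).inverse = 𝟭 (I ⥤ L ⥤ B) := by
  have hobj (F : I ⥤ L ⥤ B) :
      ((flipCurrying I L B).functor ⋙ (flipCurrying I L B).inverse).obj F = (𝟭 _).obj F :=
    congrArg Functor.flip (Functor.curry_obj_uncurry_obj F.flip)
  refine CategoryTheory.Functor.ext hobj fun F G α ↦ ?_
  ext i l
  simp only [NatTrans.comp_app, eqToHom_app]
  exact ((Category.id_comp _).trans (Category.comp_id _)).symm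

lemma flipCurrying_inverse_comp_functor :
    (flipCurrying I L B).inverse ⋙ (flipCurrying I L B).functor = 𝟭 (L × I ⥤ B) := by
  have hobj (F : L × I ⥤ B) :
      ((flipCurrying I L B).inverse ⋙ (flipCurrying I L B).functor).obj F = (𝟭 _).obj F :=
    Functor.uncurry_obj_curry_obj F
  refine CategoryTheory.Functor.ext hobj fun F G α ↦ ?_
  ext x
  simp only [NatTrans.comp_app, eqToHom_app]
  exact ((Category.id_comp _).trans (Category.comp_id _)).symm

end flipCurrying

section ofAbelianShift

variable (B : Type (u + 1)) [Category.{u} B] [Abelian B] (L : Type u) [Category.{u} L]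

/-- The isomorphism of categories `D((B^L)^I) ≅ D(B^(L × I))`. -/
def derivedFlipCurrying (I : Type u) [Category.{u} I] :
    Cat.of (Derived (I ⥤ L ⥤ B)) ≅ Cat.of (Derived (L × I ⥤ B)) where
  hom := (Derived.map (flipCurrying I L B).functor).toCatHom
  inv := (Derived.map (flipCurrying I L B).inverse).toCatHom
  hom_inv_id := Cat.Hom.ext <| (Derived.map_comp _ _).symm.trans <|
    (Derived.map_congr (flipCurrying_functor_comp_inverse I L B)).trans (Derived.map_id _)
  inv_hom_id := Cat.Hom.ext <| (Derived.map_comp _ _).symm.trans <|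
    (Derived.map_congr (flipCurrying_inverse_comp_functor I L B)).trans (Derived.map_id _)

/-- The prederivator of `B^L` is the shift of the prederivator of `B`. -/
def ofAbelianShift : StrongEquivalence (ofAbelian (L ⥤ B)) ((ofAbelian B).shift (Cat.of L)) where
  equiv := twoNaturalEquivalence (fun I ↦ derivedFlipCurrying B L I.unop)
    (fun {I J} F ↦ Cat.Hom.ext <|
      (Derived.map_comp ((Functor.whiskeringLeft _ _ (L ⥤ B)).obj F.unop.toFunctor)
        (flipCurrying J.unop L B).functor).symm.trans <|
      Derived.map_comp (flipCurrying I.unop L B).functor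
        ((Functor.whiskeringLeft _ _ B).obj (Functor.prod (𝟭 L) F.unop.toFunctor)))
    fun {I J F F'} α ↦ cat_hom₂_eq_conj _ _ _ _ fun X ↦ by
      obtain ⟨K, rfl⟩ := (Localization.Construction.objEquiv _).surjective X
      refine heq_of_eq <| (congrArg (Derived.map _).map (Derived.map₂_app
        ((Functor.whiskeringLeft _ _ (L ⥤ B)).map α.unop2.toNatTrans) K)).trans <|
          (Derived.map_Q_map _ _).trans <| Eq.trans ?_ (Derived.map₂_app
            ((Functor.whiskeringLeft _ _ B).map (NatTrans.prod (𝟙 (𝟭 L)) α.unop2.toNatTrans))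
            (((flipCurrying I.unop L B).functor.mapHomologicalComplex _).obj K)).symm
      refine congrArg (Derived.Q _).map ?_
      ext n ⟨l, j⟩
      change _ = ((K.X n).obj _).map (𝟙 l) ≫ _
      exact ((congrArg (· ≫ _) (CategoryTheory.Functor.map_id ((K.X n).obj _) l)).trans
        (Category.id_comp _)).symm
  hom_strict _ := ⟨_, rfl⟩
  inv_strict _ := ⟨_, rfl⟩

end ofAbelianShift

section strongEquivalence

variable {A : Type (u + 1)} [Category.{u} A] [Abelian A] {B : Type (u + 1)} [Category.{u} B]
  [Abelian B] {L : Type u} [Category.{u} L] (e : A ≌ (L ⥤ B))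

/-- An equivalence `A ≌ B^L` identifies the prederivator of `A` with a shift of that of `B`. -/
def strongEquivalence : StrongEquivalence (ofAbelian A) ((ofAbelian B).shift (Cat.of L)) :=
  (ofAbelianEquivalence e).trans (ofAbelianShift B L)

lemma Q_strongEquivalence_functor (I : Cat.{u, u}) :
    Derived.Q (I ⥤ A) ⋙ (strongEquivalence e).functor I =
      (diagrams e.functor I).mapHomologicalComplex (ComplexShape.up ℤ) ⋙ Derived.Q (L × I ⥤ B) :=
  (congrArg (Derived.Q _ ⋙ ·) (Derived.map_comp
    ((Functor.whiskeringRight I A _).obj e.functor) (flipCurrying I L B).functor)).symm.trans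
    (Derived.Q_map _)

end strongEquivalence

end

end Prederivator

theorem mainTheorem4_general (X : AlgebraicGeometry.Scheme.{u}) :
    ∃ e : X.affineLine.Qcoh ≌ (Loop.{u} ⥤ X.Qcoh),
      e.functor ⋙ (Functor.whiskeringRight Loop.{u} X.Qcoh X.Modules).obj X.isQcoh.ι =
        X.affineLine.isQcoh.ι ⋙ X.pushforwardLoop ∧
      ∃ Φ : Prederivator.StrongEquivalence X.affineLine.derivator
          (X.derivator.shift (Cat.of Loop.{u})),
        ∀ I : Cat.{u, u},
          Prederivator.Derived.Q (I ⥤ X.affineLine.Qcoh) ⋙ Φ.functor I =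
            (Prederivator.diagrams e.functor I).mapHomologicalComplex (ComplexShape.up ℤ) ⋙
              Prederivator.Derived.Q (Loop.{u} × I ⥤ X.Qcoh) :=
  ⟨(qcohPushforwardLoop X).asEquivalence, rfl, Prederivator.strongEquivalence _,
    Prederivator.Q_strongEquivalence_functor _⟩

theorem mainTheorem4 (X : AlgebraicGeometry.Scheme.{u}) [CompactSpace X] [X.IsSeparated] :
    ∃ e : X.affineLine.Qcoh ≌ (Loop.{u} ⥤ X.Qcoh),
      e.functor ⋙ (Functor.whiskeringRight Loop.{u} X.Qcoh X.Modules).obj X.isQcoh.ι =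
        X.affineLine.isQcoh.ι ⋙ X.pushforwardLoop ∧
      ∃ Φ : Prederivator.StrongEquivalence X.affineLine.derivator
          (X.derivator.shift (Cat.of Loop.{u})),
        ∀ I : Cat.{u, u},
          Prederivator.Derived.Q (I ⥤ X.affineLine.Qcoh) ⋙ Φ.functor I =
            (Prederivator.diagrams e.functor I).mapHomologicalComplex (ComplexShape.up ℤ) ⋙
              Prederivator.Derived.Q (Loop.{u} × I ⥤ X.Qcoh) :=
  mainTheorem4_general X
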